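/- Let $2<p<\infty$, let the scalar field be $\mathbf R$ or $\mathbf C$, and let $X$ be a closed subspace of $\ell^p$. Let $(x_n)_{n\ge1}$ be a sequence in $X$ with $\|x_n\|\le1$ for all $n$ and $\|x_n\|$ decreasing to $0$. Choose integers $0\le n_1<n_2<\cdots$ such that $\|x_n\|<2^{-k}$ whenever $n>n_k$, and put $X_k=\operatorname{span}\{x_n: n\le n_k\}$. For $0<t<1$ let $$V_t=\Big\{\sum_{k=1}^\infty \alpha_k\,\frac{a_k}{\|a_k\|^{t}} \;:\; a_k\in X_k,\ \|a_k\|\le 2^{-(k-1)},\ \sum_{k=1}^\infty|\alpha_k|^p\le1\Big\}$$ (a term with $a_k=0$ is $0$), let $W_t$ be the linear span of $V_t$, and let $|||w|||_t=\inf\{\lambda>0:\lambda^{-1}w\in V_t\}$ for $w\in W_t$. Let $\mathcal Z^\sharp$ be the linear span of the functions $w\chi_{(s,t)}$ with $0<s<t<1$ and $w\in W_s$; each $f\in\mathcal Z^\sharp$ satisfies $f(r)\in W_r$ for $0<r<1$, and $\mathcal Z^\sharp$ carries the norm $\|f\|=\big(\int_0^1|||f(r)|||_r^p\,dr\big)^{1/p}$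 (functions equal almost everywhere being identified). Let $Z^\sharp$ be the completion of $\mathcal Z^\sharp$. For $0<t<1$ and $y=(y_k)\in(\bigoplus_k X_k)_{\ell^p}$ put $Q_t y=\sum_{k=1}^\infty 2^{-(1-t)(k-1)}y_k$. A bounded linear map is called a quotient map if it carries the open unit ball of its domain onto the open unit ball of its range space. A function $g$ on $(0,1)$ with $g(r)\in W_r$ for almost every $r$ is said to represent $z\in Z^\sharp$ if there are $u_n\in\mathcal Z^\sharp$ such that $u_n\to z$ in $Z^\sharp$, the functions $r\mapsto|||g(r)-u_n(r)|||_r$ are measurable, and $\int_0^1|||g(r)-u_n(r)|||_r^p\,dr\to0$. Then: 1. There is a quotient map $Q: L^p\big((0,1),(\bigoplus_k X_k)_{\ell^p}\big)\to Z^\sharp$ such that, for every $f$, the element $Qf$ is represented by the function $t\mapsto Q_t(f(t))$. 2. $Z^\sharp$ is a quotient of a closed subspace of $L^p(0,1)$; that is, there are a closed subspace $M$ of $L^p(0,1)$ and a quotient map from $M$ to $Z^\sharp$. 3. $Z^\sharp$ is reflexive. 4. $Z^\sharp$ is uniformly convex. -/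

import Mathlib

open MeasureTheory Filter Topology Set
open scoped ENNReal

set_option linter.unusedSectionVars false

noncomputable section

namespace WillisSpace

variable {𝕜 : Type*} [RCLike 𝕜] {E : Type*} [NormedAddCommGroup E] [NormedSpace 𝕜 E]

/-! Throughout, `F 0, F 1, F 2, …` are linear subspaces of `E`; `F k` plays the role of
`X_{k+1}`, so that the radius attached to it is `(1/2)^k`. -/

/-- The set `V_t` of all sums `∑ α_k a_k / ‖a_k‖^t` with `a_k ∈ F k`, `‖a_k‖ ≤ (1/2)^k` and
`∑ |α_k|^p ≤ 1`; a term with `a_k = 0` is zero. -/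
def unitSet (p : ℝ≥0∞) (F : ℕ → Submodule 𝕜 E) (t : ℝ) : Set E :=
  {v | ∃ (α : ℕ → 𝕜) (a : ℕ → E),
    (∀ k, a k ∈ F k ∧ ‖a k‖ ≤ (1 / 2 : ℝ) ^ k) ∧
    Summable (fun k => ‖α k‖ ^ p.toReal) ∧ ∑' k, ‖α k‖ ^ p.toReal ≤ 1 ∧
    HasSum (fun k => α k • (((‖a k‖ ^ t)⁻¹ : ℝ) : 𝕜) • a k) v}

/-- The space `W_t`: the linear span of `V_t`. -/
def fiber (p : ℝ≥0∞) (F : ℕ → Submodule 𝕜 E) (t : ℝ) : Submodule 𝕜 E :=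
  Submodule.span 𝕜 (unitSet p F t)

/-- The norm of `W_t`: `inf {c > 0 : c⁻¹ w ∈ V_t}` (meaningful for `w ∈ W_t`). -/
def fiberNorm (p : ℝ≥0∞) (F : ℕ → Submodule 𝕜 E) (t : ℝ) (w : E) : ℝ :=
  sInf {c : ℝ | 0 < c ∧ ((c⁻¹ : ℝ) : 𝕜) • w ∈ unitSet p F t}

/-- The map `Q_t (y_k)_k = ∑ (1/2)^{(1-t) k} y_k`. -/
def fiberQuot (p : ℝ≥0∞) (F : ℕ → Submodule 𝕜 E) (t : ℝ)
    (y : lp (fun k => F k) p) : E :=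
  ∑' k : ℕ, (((1 / 2 : ℝ) ^ ((1 - t) * k) : ℝ) : 𝕜) • (y k : E)

/-- The linear span of the functions `w χ_{(s,t)}` with `0 < s < t < 1` and `w ∈ W_s`. (All these
functions vanish outside `(0,1)`.) -/
def stepSubmodule (p : ℝ≥0∞) (F : ℕ → Submodule 𝕜 E) : Submodule 𝕜 (ℝ → E) :=
  Submodule.span 𝕜 {f | ∃ (s t : ℝ) (w : E), 0 < s ∧ s < t ∧ t < 1 ∧ w ∈ fiber p F s ∧
    f = (Ioo s t).indicator (fun _ => w)}

/-- The same span as a type of its own, so that it can carry its own seminorm. -/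
def StepSpace (p : ℝ≥0∞) (F : ℕ → Submodule 𝕜 E) : Type _ := ↥(stepSubmodule p F)

instance (p : ℝ≥0∞) (F : ℕ → Submodule 𝕜 E) : AddCommGroup (StepSpace p F) :=
  inferInstanceAs (AddCommGroup ↥(stepSubmodule p F))

instance (p : ℝ≥0∞) (F : ℕ → Submodule 𝕜 E) : Module 𝕜 (StepSpace p F) :=
  inferInstanceAs (Module 𝕜 ↥(stepSubmodule p F))

/-- The function `(0,1) → E` underlying an element of the span. -/
def StepSpace.toFun {p : ℝ≥0∞} {F : ℕ → Submodule 𝕜 E} (f : StepSpace p F) : ℝ → E :=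
  Subtype.val f

/-- `‖f‖ = (∫₀¹ ‖f(r)‖_r^p dr)^{1/p}`, where `‖·‖_r` is the norm of `W_r`. -/
def stepNorm (p : ℝ≥0∞) (F : ℕ → Submodule 𝕜 E) (f : StepSpace p F) : ℝ :=
  (∫ r in Ioo (0 : ℝ) 1, fiberNorm p F r (f.toFun r) ^ p.toReal) ^ (1 / p.toReal)

/-! ### Facts needed to see that `stepNorm` is a seminorm -/

section Facts

variable {p : ℝ≥0∞} [Fact (1 ≤ p)] [Fact (p ≠ ∞)] {F : ℕ → Submodule 𝕜 E}

theorem toReal_pos' (p : ℝ≥0∞) [h1 : Fact (1 ≤ p)] [h2 : Fact (p ≠ ∞)] : 0 < p.toReal :=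
  ENNReal.toReal_pos (zero_lt_one.trans_le h1.out).ne' h2.out

/-- `w` is the sum of the series defining `Q_t y`. -/
def IsSum (p : ℝ≥0∞) (F : ℕ → Submodule 𝕜 E) (t : ℝ) (y : lp (fun k => F k) p) (w : E) : Prop :=
  HasSum (fun k : ℕ => (((1 / 2 : ℝ) ^ ((1 - t) * k) : ℝ) : 𝕜) • (y k : E)) w

theorem IsSum.add {t : ℝ} {y z : lp (fun k => F k) p} {v w : E}
    (hy : IsSum p F t y v) (hz : IsSum p F t z w) : IsSum p F t (y + z) (v + w) := by
  simpa [IsSum, smul_add] using HasSum.add hy hz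

theorem IsSum.smul {t : ℝ} {y : lp (fun k => F k) p} {v : E} (c : 𝕜)
    (hy : IsSum p F t y v) : IsSum p F t (c • y) (c • v) := by
  have := HasSum.const_smul c hy
  simpa [IsSum, smul_comm c] using this

theorem isSum_zero (t : ℝ) : IsSum p F t 0 0 := by
  simp [IsSum]

theorem half_rpow (s : ℝ) (k : ℕ) : (1 / 2 : ℝ) ^ (s * k) = ((1 / 2 : ℝ) ^ k) ^ s := by
  rw [mul_comm, Real.rpow_mul (by norm_num), Real.rpow_natCast]

theorem mem_unitSet_iff {t : ℝ} (ht : t < 1) {v : E} :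
    v ∈ unitSet p F t ↔ ∃ y : lp (fun k => F k) p, ‖y‖ ≤ 1 ∧ IsSum p F t y v := by
  have hp := toReal_pos' p
  constructor
  · rintro ⟨α, a, ha, hα, hα1, hv⟩
    let b : ∀ k, F k := fun k =>
      (α k * ((((‖a k‖ ^ t)⁻¹ : ℝ) : 𝕜) * ((((1 / 2 : ℝ) ^ ((1 - t) * k))⁻¹ : ℝ) : 𝕜))) •
        (⟨a k, (ha k).1⟩ : F k)
    have hb : ∀ k, ‖b k‖ ≤ ‖α k‖ := by
      intro k
      have hr : (0 : ℝ) < (1 / 2 : ℝ) ^ k := by positivity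
      have h2 : (0 : ℝ) < (1 / 2 : ℝ) ^ ((1 - t) * k) := by positivity
      have h3 : (0 : ℝ) ≤ (‖a k‖ ^ t)⁻¹ := by positivity
      have key : (‖a k‖ ^ t)⁻¹ * ‖a k‖ ≤ (1 / 2 : ℝ) ^ ((1 - t) * k) := by
        rcases eq_or_ne (a k) 0 with h | h
        · simp [h]; positivity
        · have hpos := norm_pos_iff.2 h
          rw [half_rpow]
          calc (‖a k‖ ^ t)⁻¹ * ‖a k‖ = ‖a k‖ ^ (1 - t) := by
                rw [Real.rpow_sub hpos, Real.rpow_one]; ring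
            _ ≤ _ := Real.rpow_le_rpow hpos.le (ha k).2 (by linarith)
      have h4 : ‖b k‖ = ‖α k‖ * (((‖a k‖ ^ t)⁻¹ * ((1 / 2 : ℝ) ^ ((1 - t) * k))⁻¹) * ‖a k‖) := by
        simp only [b, norm_smul, norm_mul, RCLike.norm_ofReal, abs_of_nonneg h3,
          abs_of_nonneg (inv_pos.2 h2).le]
        rw [mul_assoc]; rfl
      rw [h4]
      refine mul_le_of_le_one_right (norm_nonneg _) ?_
      calc _ = ((‖a k‖ ^ t)⁻¹ * ‖a k‖) / ((1 / 2 : ℝ) ^ ((1 - t) * k)) := by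
            rw [div_eq_mul_inv]; ring
        _ ≤ 1 := (div_le_one h2).2 key
    have hb' : ∀ k, ‖b k‖ ^ p.toReal ≤ ‖α k‖ ^ p.toReal := fun k =>
      Real.rpow_le_rpow (norm_nonneg _) (hb k) hp.le
    have hsum : Summable fun k => ‖b k‖ ^ p.toReal :=
      Summable.of_nonneg_of_le (fun k => by positivity) hb' hα
    refine ⟨⟨b, memℓp_gen hsum⟩, ?_, ?_⟩
    · refine lp.norm_le_of_tsum_le hp zero_le_one ?_
      rw [Real.one_rpow]
      exact (hsum.tsum_le_tsum hb' hα).trans hα1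
    · unfold IsSum
      convert! hv using 2 with k
      have h2 : (((1 / 2 : ℝ) ^ ((1 - t) * k) : ℝ) : 𝕜) ≠ 0 := by
        have : (0 : ℝ) < (1 / 2 : ℝ) ^ ((1 - t) * k) := by positivity
        exact_mod_cast this.ne'
      simp only [b, Submodule.coe_smul, smul_smul]
      congr 1
      rw [RCLike.ofReal_inv ((1 / 2 : ℝ) ^ ((1 - t) * k))]
      field_simp
  · rintro ⟨y, hy, hv⟩
    refine ⟨fun k => ((‖y k‖ : ℝ) : 𝕜),
      fun k => ((((1 / 2 : ℝ) ^ k * ‖y k‖⁻¹ : ℝ)) : 𝕜) • (y k : E), ?_, ?_, ?_, ?_⟩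
    · intro k
      refine ⟨(F k).smul_mem _ (y k).2, ?_⟩
      rw [norm_smul, RCLike.norm_ofReal, abs_of_nonneg (by positivity), mul_assoc]
      refine mul_le_of_le_one_right (by positivity) ?_
      exact inv_mul_le_one
    · simpa using (lp.memℓp y).summable hp
    · simp only [RCLike.norm_ofReal, abs_norm]
      rw [← lp.norm_rpow_eq_tsum hp]
      exact Real.rpow_le_one (norm_nonneg _) hy hp.le
    · unfold IsSum at hv
      convert! hv using 2 with k
      rcases eq_or_ne (y k) 0 with h | h
      · simp [h]
      · have hpos : 0 < ‖y k‖ := norm_pos_iff.2 h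
        have hr : (0 : ℝ) < (1 / 2 : ℝ) ^ k := by positivity
        have hn : ‖((((1 / 2 : ℝ) ^ k * ‖y k‖⁻¹ : ℝ)) : 𝕜) • (y k : E)‖ = (1 / 2 : ℝ) ^ k := by
          rw [norm_smul, RCLike.norm_ofReal, abs_of_nonneg (by positivity), mul_assoc]
          change _ * (‖y k‖⁻¹ * ‖y k‖) = _
          rw [inv_mul_cancel₀ hpos.ne', mul_one]
        rw [hn, smul_smul, smul_smul, ← RCLike.ofReal_mul, ← RCLike.ofReal_mul, half_rpow,
          Real.rpow_sub hr, Real.rpow_one]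
        congr 2
        field_simp

theorem mem_normSet_iff {t : ℝ} (ht : t < 1) {c : ℝ} (hc : 0 < c) {w : E} :
    ((c⁻¹ : ℝ) : 𝕜) • w ∈ unitSet p F t ↔
      ∃ y : lp (fun k => F k) p, ‖y‖ ≤ c ∧ IsSum p F t y w := by
  have hc' : ((c : ℝ) : 𝕜) ≠ 0 := by exact_mod_cast hc.ne'
  rw [mem_unitSet_iff ht]
  constructor
  · rintro ⟨y, hy, h⟩
    refine ⟨(c : 𝕜) • y, ?_, ?_⟩
    · rw [norm_smul, RCLike.norm_ofReal, abs_of_pos hc]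
      exact mul_le_of_le_one_right hc.le hy
    · simpa [smul_smul, hc'] using h.smul (c : 𝕜)
  · rintro ⟨y, hy, h⟩
    refine ⟨((c⁻¹ : ℝ) : 𝕜) • y, ?_, h.smul _⟩
    rw [norm_smul, RCLike.norm_ofReal, abs_of_pos (inv_pos.2 hc)]
    exact (inv_mul_le_one₀ hc).2 hy

theorem mem_fiber_iff {t : ℝ} (ht : t < 1) {w : E} :
    w ∈ fiber p F t ↔ ∃ y : lp (fun k => F k) p, IsSum p F t y w := by
  constructor
  · intro hw
    induction hw using Submodule.span_induction with
    | mem v hv => exact ((mem_unitSet_iff ht).1 hv).imp fun y hy => hy.2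
    | zero => exact ⟨0, isSum_zero t⟩
    | add v w _ _ hv hw =>
      obtain ⟨y, hy⟩ := hv
      obtain ⟨z, hz⟩ := hw
      exact ⟨y + z, hy.add hz⟩
    | smul c v _ hv =>
      obtain ⟨y, hy⟩ := hv
      exact ⟨c • y, hy.smul c⟩
  · rintro ⟨y, hy⟩
    have hc : 0 < ‖y‖ + 1 := by positivity
    have h := (mem_normSet_iff ht hc).2 ⟨y, by linarith, hy⟩
    have h2 := (fiber p F t).smul_mem ((‖y‖ + 1 : ℝ) : 𝕜) (Submodule.subset_span h)
    have hc' : ((‖y‖ + 1 : ℝ) : 𝕜) ≠ 0 := by exact_mod_cast hc.ne'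
    rw [smul_smul, ← RCLike.ofReal_mul, mul_inv_cancel₀ hc.ne'] at h2
    simpa using h2

theorem fiberNorm_nonneg (t : ℝ) (w : E) : 0 ≤ fiberNorm p F t w :=
  Real.sInf_nonneg fun _ h => h.1.le

theorem fiberNorm_le {t : ℝ} (ht : t < 1) {y : lp (fun k => F k) p} {w : E}
    (h : IsSum p F t y w) : fiberNorm p F t w ≤ ‖y‖ := by
  refine le_of_forall_pos_le_add fun ε hε => csInf_le ⟨0, fun _ h => h.1.le⟩ ?_
  have hc : 0 < ‖y‖ + ε := by positivity
  exact ⟨hc, (mem_normSet_iff ht hc).2 ⟨y, by linarith, h⟩⟩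

theorem exists_lt_fiberNorm_add {t : ℝ} (ht : t < 1) {w : E} (hw : w ∈ fiber p F t) {ε : ℝ}
    (hε : 0 < ε) : ∃ y : lp (fun k => F k) p, ‖y‖ < fiberNorm p F t w + ε ∧ IsSum p F t y w := by
  obtain ⟨z, hz⟩ := (mem_fiber_iff ht).1 hw
  have hne : {c : ℝ | 0 < c ∧ ((c⁻¹ : ℝ) : 𝕜) • w ∈ unitSet p F t}.Nonempty := by
    have hc : 0 < ‖z‖ + 1 := by positivity
    exact ⟨_, hc, (mem_normSet_iff ht hc).2 ⟨z, by linarith, hz⟩⟩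
  obtain ⟨c, ⟨hc, hcw⟩, hlt⟩ := exists_lt_of_csInf_lt hne
    (show fiberNorm p F t w < fiberNorm p F t w + ε by linarith)
  obtain ⟨y, hy, h⟩ := (mem_normSet_iff ht hc).1 hcw
  exact ⟨y, hy.trans_lt hlt, h⟩

theorem fiberNorm_add_le {t : ℝ} (ht : t < 1) {v w : E} (hv : v ∈ fiber p F t)
    (hw : w ∈ fiber p F t) :
    fiberNorm p F t (v + w) ≤ fiberNorm p F t v + fiberNorm p F t w := by
  refine le_of_forall_pos_le_add fun ε hε => ?_
  obtain ⟨y, hy, h⟩ := exists_lt_fiberNorm_add ht hv (half_pos hε)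
  obtain ⟨z, hz, h'⟩ := exists_lt_fiberNorm_add ht hw (half_pos hε)
  linarith [fiberNorm_le ht (h.add h'), norm_add_le y z]

theorem fiberNorm_smul_le {t : ℝ} (ht : t < 1) {w : E} (hw : w ∈ fiber p F t) (c : 𝕜) :
    fiberNorm p F t (c • w) ≤ ‖c‖ * fiberNorm p F t w := by
  refine le_of_forall_pos_le_add fun ε hε => ?_
  have hc : 0 < ‖c‖ + 1 := by positivity
  obtain ⟨y, hy, h⟩ := exists_lt_fiberNorm_add ht hw (div_pos hε hc)
  have h1 := fiberNorm_le ht (h.smul c)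
  rw [norm_smul] at h1
  have h2 : ‖c‖ * ‖y‖ ≤ ‖c‖ * (fiberNorm p F t w + ε / (‖c‖ + 1)) := by gcongr
  have h3 : ‖c‖ * (ε / (‖c‖ + 1)) ≤ ε := by
    rw [mul_div_assoc', div_le_iff₀ hc]; nlinarith [norm_nonneg c]
  linarith

theorem fiberNorm_zero {t : ℝ} (ht : t < 1) : fiberNorm p F t (0 : E) = 0 :=
  le_antisymm (by simpa using fiberNorm_le (p := p) (F := F) ht (isSum_zero t))
    (fiberNorm_nonneg t 0)

theorem exists_isSum_of_le {s t : ℝ} (hst : s ≤ t) {y : lp (fun k => F k) p} {w : E}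
    (h : IsSum p F s y w) : ∃ z : lp (fun k => F k) p, ‖z‖ ≤ ‖y‖ ∧ IsSum p F t z w := by
  have hp := toReal_pos' p
  let b : ∀ k, F k := fun k => (((1 / 2 : ℝ) ^ ((t - s) * k) : ℝ) : 𝕜) • y k
  have hb : ∀ k, ‖b k‖ ≤ ‖y k‖ := by
    intro k
    simp only [b, norm_smul, RCLike.norm_ofReal]
    rw [abs_of_nonneg (by positivity)]
    refine mul_le_of_le_one_left (norm_nonneg _) ?_
    exact Real.rpow_le_one (by norm_num) (by norm_num)
      (mul_nonneg (by linarith) (Nat.cast_nonneg k))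
  have hb' : ∀ k, ‖b k‖ ^ p.toReal ≤ ‖y k‖ ^ p.toReal := fun k =>
    Real.rpow_le_rpow (norm_nonneg _) (hb k) hp.le
  have hys := (lp.memℓp y).summable hp
  have hsum : Summable fun k => ‖b k‖ ^ p.toReal :=
    Summable.of_nonneg_of_le (fun k => by positivity) hb' hys
  refine ⟨⟨b, memℓp_gen hsum⟩, ?_, ?_⟩
  · refine lp.norm_le_of_tsum_le hp (norm_nonneg _) ?_
    rw [lp.norm_rpow_eq_tsum hp]
    exact hsum.tsum_le_tsum hb' hys
  · unfold IsSum at h ⊢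
    convert! h using 2 with k
    simp only [b, Submodule.coe_smul, smul_smul]
    rw [← RCLike.ofReal_mul, ← Real.rpow_add (by norm_num)]
    congr 3
    ring

theorem fiber_mono {s t : ℝ} (hst : s ≤ t) (ht : t < 1) : fiber p F s ≤ fiber p F t := by
  intro w hw
  obtain ⟨y, hy⟩ := (mem_fiber_iff (hst.trans_lt ht)).1 hw
  obtain ⟨z, -, hz⟩ := exists_isSum_of_le hst hy
  exact (mem_fiber_iff ht).2 ⟨z, hz⟩

theorem fiberNorm_anti {s t : ℝ} (hst : s ≤ t) (ht : t < 1) {w : E} (hw : w ∈ fiber p F s) :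
    fiberNorm p F t w ≤ fiberNorm p F s w := by
  refine le_of_forall_pos_le_add fun ε hε => ?_
  obtain ⟨y, hy, h⟩ := exists_lt_fiberNorm_add (hst.trans_lt ht) hw hε
  obtain ⟨z, hz, h'⟩ := exists_isSum_of_le hst h
  linarith [fiberNorm_le ht h']

theorem StepSpace.mem_fiber (f : StepSpace p F) {r : ℝ} (hr : r < 1) :
    f.toFun r ∈ fiber p F r := by
  obtain ⟨f, hf⟩ := f
  change f r ∈ _
  induction hf using Submodule.span_induction with
  | mem f hf =>
    obtain ⟨s, t, w, _, _, _, hw, rfl⟩ := hf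
    by_cases h : r ∈ Ioo s t
    · rw [indicator_of_mem h]
      exact fiber_mono h.1.le hr hw
    · rw [indicator_of_notMem h]
      exact zero_mem _
  | zero => exact zero_mem _
  | add f g _ _ hf hg => exact add_mem hf hg
  | smul c f _ hf => exact Submodule.smul_mem _ c hf

theorem StepSpace.exists_bound (f : StepSpace p F) :
    ∃ C : ℝ, ∀ r < 1, fiberNorm p F r (f.toFun r) ≤ C := by
  obtain ⟨f, hf⟩ := f
  change ∃ C : ℝ, ∀ r < 1, fiberNorm p F r (f r) ≤ C
  induction hf using Submodule.span_induction with
  | mem f hf =>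
    obtain ⟨s, t, w, _, _, _, hw, rfl⟩ := hf
    refine ⟨fiberNorm p F s w, fun r hr => ?_⟩
    by_cases h : r ∈ Ioo s t
    · rw [indicator_of_mem h]
      exact fiberNorm_anti h.1.le hr hw
    · rw [indicator_of_notMem h, fiberNorm_zero hr]
      exact fiberNorm_nonneg s w
  | zero => exact ⟨0, fun r hr => (fiberNorm_zero hr).le⟩
  | add f g hf' hg' hf hg =>
    obtain ⟨C, hC⟩ := hf
    obtain ⟨D, hD⟩ := hg
    refine ⟨C + D, fun r hr => ?_⟩
    exact (fiberNorm_add_le hr (StepSpace.mem_fiber ⟨f, hf'⟩ hr)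
      (StepSpace.mem_fiber ⟨g, hg'⟩ hr)).trans (add_le_add (hC r hr) (hD r hr))
  | smul c f hf' hf =>
    obtain ⟨C, hC⟩ := hf
    refine ⟨‖c‖ * C, fun r hr => ?_⟩
    exact (fiberNorm_smul_le hr (StepSpace.mem_fiber ⟨f, hf'⟩ hr) c).trans
      (mul_le_mul_of_nonneg_left (hC r hr) (norm_nonneg c))

theorem StepSpace.exists_finset (f : StepSpace p F) :
    ∃ A : Finset ℝ, ∀ a b : ℝ, a ≤ b → (∀ x ∈ Icc a b, x ∉ A) → f.toFun a = f.toFun b := by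
  classical
  obtain ⟨f, hf⟩ := f
  change ∃ A : Finset ℝ, ∀ a b : ℝ, a ≤ b → (∀ x ∈ Icc a b, x ∉ A) → f a = f b
  induction hf using Submodule.span_induction with
  | mem f hf =>
    obtain ⟨s, t, w, _, _, _, hw, rfl⟩ := hf
    refine ⟨{s, t}, fun a b hab h => ?_⟩
    have hs : s ∉ Icc a b := fun hx => h s hx (by simp)
    have ht : t ∉ Icc a b := fun hx => h t hx (by simp)
    simp only [mem_Icc, not_and_or, not_le] at hs ht
    have : a ∈ Ioo s t ↔ b ∈ Ioo s t := by
      simp only [mem_Ioo]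
      constructor
      · rintro ⟨h1, h2⟩
        exact ⟨by linarith, by rcases ht with h | h <;> linarith⟩
      · rintro ⟨h1, h2⟩
        exact ⟨by rcases hs with h | h <;> linarith, by linarith⟩
    by_cases ha : a ∈ Ioo s t
    · rw [indicator_of_mem ha, indicator_of_mem (this.1 ha)]
    · rw [indicator_of_notMem ha, indicator_of_notMem (fun hb => ha (this.2 hb))]
  | zero => exact ⟨∅, fun _ _ _ _ => rfl⟩
  | add f g _ _ hf hg =>
    obtain ⟨A, hA⟩ := hf
    obtain ⟨B, hB⟩ := hg
    refine ⟨A ∪ B, fun a b hab h => ?_⟩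
    change f a + g a = f b + g b
    rw [hA a b hab fun x hx hxA => h x hx (Finset.mem_union_left _ hxA),
      hB a b hab fun x hx hxB => h x hx (Finset.mem_union_right _ hxB)]
  | smul c f _ hf =>
    obtain ⟨A, hA⟩ := hf
    refine ⟨A, fun a b hab h => ?_⟩
    change c • f a = c • f b
    rw [hA a b hab h]

theorem StepSpace.aemeasurable (f : StepSpace p F) :
    AEMeasurable (fun r => fiberNorm p F r (f.toFun r)) (volume.restrict (Ioo (0 : ℝ) 1)) := by
  obtain ⟨A, hA⟩ := f.exists_finset
  let ι := {q : ℚ × ℚ // Ioo (q.1 : ℝ) q.2 ⊆ Ioo 0 1 \ A}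
  have hU : AEMeasurable (fun r => fiberNorm p F r (f.toFun r))
      (volume.restrict (⋃ q : ι, Ioo (q.1.1 : ℝ) q.1.2)) := by
    rw [aemeasurable_iUnion_iff]
    rintro ⟨q, hq⟩
    refine aemeasurable_restrict_of_antitoneOn measurableSet_Ioo ?_
    intro a ha b hb hab
    have hfab : f.toFun a = f.toFun b := hA a b hab fun x hx =>
      (hq ⟨ha.1.trans_le hx.1, hx.2.trans_lt hb.2⟩).2
    change fiberNorm p F b (f.toFun b) ≤ fiberNorm p F a (f.toFun a)
    rw [← hfab]
    exact fiberNorm_anti hab (hq hb).1.2 (f.mem_fiber (hq ha).1.2)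
  have hsub : Ioo (0 : ℝ) 1 \ A ⊆ ⋃ q : ι, Ioo (q.1.1 : ℝ) q.1.2 := by
    intro r hr
    have hopen : IsOpen (Ioo (0 : ℝ) 1 \ A) := isOpen_Ioo.sdiff A.finite_toSet.isClosed
    obtain ⟨l, u, hlu, hsub⟩ := mem_nhds_iff_exists_Ioo_subset.1 (hopen.mem_nhds hr)
    obtain ⟨q1, h1, h1'⟩ := exists_rat_btwn hlu.1
    obtain ⟨q2, h2, h2'⟩ := exists_rat_btwn hlu.2
    refine mem_iUnion.2 ⟨⟨(q1, q2), fun x hx => hsub ⟨?_, ?_⟩⟩, h1', h2⟩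
    · exact h1.trans hx.1
    · exact hx.2.trans h2'
  have hnull : (Ioo (0 : ℝ) 1 \ A : Set ℝ) =ᵐ[volume] Ioo (0 : ℝ) 1 :=
    sdiff_null_ae_eq_self (A.finite_toSet.measure_zero _)
  rw [← Measure.restrict_congr_set hnull]
  exact hU.mono_measure (Measure.restrict_mono hsub le_rfl)

theorem StepSpace.memLp (f : StepSpace p F) :
    MemLp (fun r => fiberNorm p F r (f.toFun r)) p (volume.restrict (Ioo (0 : ℝ) 1)) := by
  obtain ⟨C, hC⟩ := f.exists_bound
  refine MemLp.of_bound f.aemeasurable.aestronglyMeasurable C ?_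
  filter_upwards [ae_restrict_mem measurableSet_Ioo] with r hr
  rw [Real.norm_of_nonneg (fiberNorm_nonneg r _)]
  exact hC r hr.2

theorem stepNorm_eq (f : StepSpace p F) :
    stepNorm p F f =
      (eLpNorm (fun r => fiberNorm p F r (f.toFun r)) p
        (volume.restrict (Ioo (0 : ℝ) 1))).toReal := by
  have h1 : (1 : ℝ≥0∞) ≤ p := Fact.out
  rw [f.memLp.eLpNorm_eq_integral_rpow_norm (zero_lt_one.trans_le h1).ne' Fact.out,
    ENNReal.toReal_ofReal (by positivity)]
  simp only [Real.norm_of_nonneg (fiberNorm_nonneg _ _), stepNorm, one_div]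

theorem stepNorm_add_le (f g : StepSpace p F) :
    stepNorm p F (f + g) ≤ stepNorm p F f + stepNorm p F g := by
  have h1 : (1 : ℝ≥0∞) ≤ p := Fact.out
  rw [stepNorm_eq, stepNorm_eq, stepNorm_eq, ← ENNReal.toReal_add f.memLp.2.ne g.memLp.2.ne]
  refine ENNReal.toReal_mono (ENNReal.add_ne_top.2 ⟨f.memLp.2.ne, g.memLp.2.ne⟩) ?_
  refine le_trans ?_ (eLpNorm_add_le f.memLp.1 g.memLp.1 h1)
  refine eLpNorm_mono_ae ?_
  filter_upwards [ae_restrict_mem measurableSet_Ioo] with r hr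
  rw [Real.norm_of_nonneg (fiberNorm_nonneg r _)]
  exact (fiberNorm_add_le hr.2 (f.mem_fiber hr.2) (g.mem_fiber hr.2)).trans (le_abs_self _)

theorem stepNorm_smul_le (c : 𝕜) (f : StepSpace p F) :
    stepNorm p F (c • f) ≤ ‖c‖ * stepNorm p F f := by
  rw [stepNorm_eq, stepNorm_eq]
  have h : eLpNorm (fun r => fiberNorm p F r ((c • f).toFun r)) p (volume.restrict (Ioo (0 : ℝ) 1))
      ≤ ENNReal.ofReal ‖c‖ * eLpNorm (fun r => fiberNorm p F r (f.toFun r)) p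
        (volume.restrict (Ioo (0 : ℝ) 1)) := by
    refine eLpNorm_le_mul_eLpNorm_of_ae_le_mul ?_ p
    filter_upwards [ae_restrict_mem measurableSet_Ioo] with r hr
    rw [Real.norm_of_nonneg (fiberNorm_nonneg r _), Real.norm_of_nonneg (fiberNorm_nonneg r _)]
    exact fiberNorm_smul_le hr.2 (f.mem_fiber hr.2) c
  have h' := ENNReal.toReal_mono (ENNReal.mul_ne_top ENNReal.ofReal_ne_top f.memLp.2.ne) h
  rwa [ENNReal.toReal_mul, ENNReal.toReal_ofReal (norm_nonneg c)] at h'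

theorem stepNorm_zero : stepNorm p F (0 : StepSpace p F) = 0 := by
  refine le_antisymm ?_ ?_
  · simpa using stepNorm_smul_le (0 : 𝕜) (0 : StepSpace p F)
  · rw [stepNorm_eq]; exact ENNReal.toReal_nonneg

end Facts

/-- `stepNorm` as a seminorm. -/
def stepSeminorm (p : ℝ≥0∞) [Fact (1 ≤ p)] [Fact (p ≠ ∞)] (F : ℕ → Submodule 𝕜 E) :
    Seminorm 𝕜 (StepSpace p F) :=
  Seminorm.ofSMulLE (stepNorm p F) stepNorm_zero stepNorm_add_le stepNorm_smul_le

instance (p : ℝ≥0∞) [Fact (1 ≤ p)] [Fact (p ≠ ∞)] (F : ℕ → Submodule 𝕜 E) :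
    SeminormedAddCommGroup (StepSpace p F) :=
  (stepSeminorm p F).toAddGroupSeminorm.toSeminormedAddCommGroup

instance (p : ℝ≥0∞) [Fact (1 ≤ p)] [Fact (p ≠ ∞)] (F : ℕ → Submodule 𝕜 E) :
    NormedSpace 𝕜 (StepSpace p F) where
  norm_smul_le c f := stepNorm_smul_le c f

theorem norm_def (p : ℝ≥0∞) [Fact (1 ≤ p)] [Fact (p ≠ ∞)] (F : ℕ → Submodule 𝕜 E)
    (f : StepSpace p F) :
    ‖f‖ = (∫ r in Ioo (0 : ℝ) 1, fiberNorm p F r (f.toFun r) ^ p.toReal) ^ (1 / p.toReal) := rfl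

/-- The Banach space `Z^♯`: the (separated) completion of the span. Functions of norm zero are
those vanishing almost everywhere, and they are identified with `0`. -/
abbrev ZSharp (p : ℝ≥0∞) [Fact (1 ≤ p)] [Fact (p ≠ ∞)] (F : ℕ → Submodule 𝕜 E) : Type _ :=
  UniformSpace.Completion (StepSpace p F)

/-- The element `z` of `Z^♯` is (the class of) the function `g`, where `g(r) ∈ W_r` for almost all
`r ∈ (0,1)`: some sequence `u_n` in the span tends to `z` in `Z^♯` and satisfies
`∫₀¹ ‖g(r) - u_n(r)‖_r^p dr → 0`. -/
def Represents (p : ℝ≥0∞) [Fact (1 ≤ p)] [Fact (p ≠ ∞)] (F : ℕ → Submodule 𝕜 E)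
    (g : ℝ → E) (z : ZSharp p F) : Prop :=
  (∀ᵐ r ∂volume.restrict (Ioo (0 : ℝ) 1), g r ∈ fiber p F r) ∧
  ∃ u : ℕ → StepSpace p F,
    Tendsto (fun n => (u n : ZSharp p F)) atTop (𝓝 z) ∧
    (∀ n, AEMeasurable (fun r => fiberNorm p F r (g r - (u n).toFun r))
      (volume.restrict (Ioo (0 : ℝ) 1))) ∧
    Tendsto (fun n => ∫⁻ r in Ioo (0 : ℝ) 1,
      ENNReal.ofReal (fiberNorm p F r (g r - (u n).toFun r)) ^ p.toReal) atTop (𝓝 0)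

/-- For a linear map `T` between normed spaces this says that `T` is a quotient map: it carries the
open unit ball onto the open unit ball; equivalently, it induces an isometric isomorphism of
`A ⧸ ker T` onto `B`. -/
def IsMetricQuotientMap {A B : Type*} [SeminormedAddCommGroup A] [SeminormedAddCommGroup B]
    (T : A → B) : Prop :=
  T '' Metric.ball 0 1 = Metric.ball 0 1

/-- The subspaces spanned by initial segments of a sequence. -/
def initialSpan (x : ℕ → E) (N : ℕ → ℕ) (k : ℕ) : Submodule 𝕜 E :=
  Submodule.span 𝕜 {v | ∃ m < N k, v = x m}

end WillisSpace

end

/-! Write Y for the ℓ^p-sum of the X_k. Normalizing the terms a_k shows that W_t carries the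
quotient norm of Y under Q_t. For t ≤ r one has Q_t y = Q_r(Dy), where D multiplies the k-th
coordinate by (1/2)^((r-t)k) and is a contraction. A lift of a vector at the parameter t can
therefore be carried continuously to later parameters without gaining norm. In particular W_t grows
and its norm decreases as t increases.

The map f ↦ (t ↦ Q_t(f t)) is first defined on those f whose image is a step function. They are
dense (`exists_lifts_near`), and the map is a contraction on them because fibre norms are infima
over lifts, so it extends to all of L^p((0,1), Y). Conversely, every step function has an almost
norm-preserving lift, up to a small error (`exists_lifts_norm_le`): on each cell of a fine grid,
lift the value at the left endpoint and carry the lift along the cell. Successive approximation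
(`isMetricQuotientMap_of_approx`) then makes the extension a quotient map.

As the X_k lie in ℓ^p, the norm of Y is the ℓ^p-norm of countably many scalar coordinates. Spreading
these over disjoint dyadic intervals embeds L^p((0,1), Y) isometrically into L^p(0,1). Clarkson's
inequality with exponent p ≥ 2 holds for scalars and survives integration, isometric embeddings and
quotients, so Z^♯ is uniformly convex. Reflexivity is then the Milman–Pettis theorem. -/

namespace WillisSpace

/-- The first Clarkson inequality with exponent `q`. -/
def Clarkson (q : ℝ) (E : Type*) [SeminormedAddCommGroup E] : Prop :=
  ∀ x y : E, ‖x + y‖ ^ q + ‖x - y‖ ^ q ≤ 2 ^ (q - 1) * (‖x‖ ^ q + ‖y‖ ^ q)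

/-! ### Quotient maps, and what Clarkson's inequality inherits and implies. -/

section MetricQuotient

variable {𝕜 : Type*} [RCLike 𝕜]
variable {A B : Type*} [NormedAddCommGroup A] [NormedSpace 𝕜 A] [NormedAddCommGroup B]
  [NormedSpace 𝕜 B]

theorem exists_preimage_norm_lt_of_ball {T : A →L[𝕜] B}
    (hT : ∀ z : B, ‖z‖ < 1 → ∃ a, T a = z ∧ ‖a‖ < 1) {z : B} {c : ℝ} (hc : ‖z‖ < c) :
    ∃ a, T a = z ∧ ‖a‖ < c := by
  have hc0 : 0 < c := (norm_nonneg z).trans_lt hc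
  have hc' : (c : 𝕜) ≠ 0 := by exact_mod_cast hc0.ne'
  have h1 : ‖((c⁻¹ : ℝ) : 𝕜) • z‖ < 1 := by
    rw [norm_smul, RCLike.norm_ofReal, abs_of_pos (inv_pos.2 hc0), inv_mul_lt_one₀ hc0]
    exact hc
  obtain ⟨a, ha, ha1⟩ := hT _ h1
  refine ⟨(c : 𝕜) • a, ?_, ?_⟩
  · rw [map_smul, ha, smul_smul, RCLike.ofReal_inv, mul_inv_cancel₀ hc', one_smul]
  · rw [norm_smul, RCLike.norm_ofReal, abs_of_pos hc0]
    exact mul_lt_of_lt_one_right hc0 ha1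

theorem IsMetricQuotientMap.exists_preimage_norm_lt {T : A →L[𝕜] B} (hT : IsMetricQuotientMap T)
    {z : B} {c : ℝ} (hc : ‖z‖ < c) : ∃ a, T a = z ∧ ‖a‖ < c := by
  refine exists_preimage_norm_lt_of_ball (fun z hz => ?_) hc
  have : z ∈ T '' Metric.ball 0 1 := by rw [hT]; simpa using hz
  obtain ⟨a, ha, rfl⟩ := this
  exact ⟨a, rfl, by simpa using ha⟩

theorem IsMetricQuotientMap.norm_le {T : A →L[𝕜] B} (hT : IsMetricQuotientMap T) (a : A) :
    ‖T a‖ ≤ ‖a‖ := by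
  refine le_of_forall_gt fun c hc => ?_
  have hc0 : 0 < c := (norm_nonneg a).trans_lt hc
  have h1 : ‖((c⁻¹ : ℝ) : 𝕜) • a‖ < 1 := by
    rw [norm_smul, RCLike.norm_ofReal, abs_of_pos (inv_pos.2 hc0), inv_mul_lt_one₀ hc0]
    exact hc
  have h2 : T (((c⁻¹ : ℝ) : 𝕜) • a) ∈ Metric.ball (0 : B) 1 := by
    rw [← hT]; exact mem_image_of_mem _ (by simpa using h1)
  rw [mem_ball_zero_iff, map_smul, norm_smul, RCLike.norm_ofReal, abs_of_pos (inv_pos.2 hc0),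
    inv_mul_lt_one₀ hc0] at h2
  exact h2

/-- Successive approximation, as in the open mapping theorem: correct the residual repeatedly with
summable errors. Only the first correction costs about ‖z‖, so the exact preimage still has almost
the norm of z. -/
theorem isMetricQuotientMap_of_approx [CompleteSpace A] (T : A →L[𝕜] B)
    (hle : ∀ a, ‖T a‖ ≤ ‖a‖)
    (h : ∀ z : B, ∀ ε > 0, ∃ a, ‖a‖ ≤ ‖z‖ + ε ∧ ‖z - T a‖ ≤ ε) : IsMetricQuotientMap T := by
  have key : ∀ z : B, ∀ ε > 0, ∃ a, T a = z ∧ ‖a‖ ≤ ‖z‖ + ε := by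
    intro z ε hε
    choose! s hs1 hs2 using h
    -- The first correction costs at most ‖z‖ + ε/6 and the later ones at most 2 ∑ η n = 2ε/3, which
    -- stays below ‖z‖ + ε.
    let η : ℕ → ℝ := fun n => ε / 6 * (1 / 2) ^ n
    have hη : ∀ n, 0 < η n := fun n => by positivity
    let zs : ℕ → B := fun n => n.rec z (fun k w => w - T (s w (η k)))
    have hz0 : zs 0 = z := rfl
    have hzs : ∀ n, zs (n + 1) = zs n - T (s (zs n) (η n)) := fun n => rfl
    let a : ℕ → A := fun n => s (zs n) (η n)
    have hzn : ∀ n, ‖zs (n + 1)‖ ≤ η n := fun n => hs2 _ _ (hη n)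
    have hη2 : ∀ n, η (n + 1) ≤ η n := fun n => by
      have := hη n
      simp only [η, pow_succ] at this ⊢; linarith
    have han : ∀ n, ‖a (n + 1)‖ ≤ 2 * η n := fun n => by
      have := hs1 (zs (n + 1)) (η (n + 1)) (hη _)
      change ‖s _ _‖ ≤ _
      linarith [hzn n, hη2 n]
    have hηs : HasSum η (ε / 3) := by
      have := hasSum_geometric_two.mul_left (ε / 6)
      convert! this using 1
      ring
    have hsum1 : Summable fun n => ‖a (n + 1)‖ :=
      Summable.of_nonneg_of_le (fun _ => norm_nonneg _) han (hηs.summable.mul_left 2)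
    have hsum : Summable fun n => ‖a n‖ := (summable_nat_add_iff 1).1 hsum1
    have hpart : ∀ n, T (∑ i ∈ Finset.range n, a i) = z - zs n := by
      intro n
      induction n with
      | zero => simp [hz0]
      | succ n ih => rw [Finset.sum_range_succ, map_add, ih, hzs]; simp only [a]; abel
    have hzlim : Tendsto zs atTop (𝓝 0) := by
      rw [← tendsto_add_atTop_iff_nat 1]
      exact squeeze_zero_norm hzn hηs.summable.tendsto_atTop_zero
    refine ⟨∑' n, a n, ?_, ?_⟩
    · have h1 := (T.continuous.tendsto _).comp hsum.of_norm.hasSum.tendsto_sum_nat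
      have h2 : Tendsto (fun n => z - zs n) atTop (𝓝 (z - 0)) := hzlim.const_sub z
      rw [sub_zero] at h2
      exact tendsto_nhds_unique h1 (h2.congr fun n => (hpart n).symm)
    · refine (norm_tsum_le_tsum_norm hsum).trans ?_
      rw [hsum.tsum_eq_zero_add]
      have h1 := hs1 z (η 0) (hη 0)
      have h2 : ∑' n, ‖a (n + 1)‖ ≤ 2 * (ε / 3) := by
        rw [← hηs.tsum_eq, ← tsum_mul_left]
        exact hsum1.tsum_le_tsum han (hηs.summable.mul_left 2)
      have h3 : η 0 = ε / 6 := by simp [η]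
      have h4 : ‖a 0‖ ≤ ‖z‖ + ε / 6 := by rw [← h3]; exact h1
      linarith
  refine Subset.antisymm ?_ ?_
  · rintro _ ⟨a, ha, rfl⟩
    rw [mem_ball_zero_iff] at ha ⊢
    exact (hle a).trans_lt ha
  · intro z hz
    rw [mem_ball_zero_iff] at hz
    obtain ⟨a, ha, ha1⟩ := key z ((1 - ‖z‖) / 2) (by linarith)
    exact ⟨a, by rw [mem_ball_zero_iff]; linarith, ha⟩

/-- Lift both vectors almost isometrically. The left side only decreases under the contraction `T`,
and the right side involves only the norms of the two lifts; then let ε → 0. -/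
theorem Clarkson.of_isMetricQuotientMap {q : ℝ} (hq : 0 < q) (hA : Clarkson q A) {T : A →L[𝕜] B}
    (hT : IsMetricQuotientMap T) : Clarkson q B := by
  intro z w
  have hlim : Tendsto (fun ε : ℝ => (2 : ℝ) ^ (q - 1) * ((‖z‖ + ε) ^ q + (‖w‖ + ε) ^ q)) (𝓝[>] 0)
      (𝓝 (2 ^ (q - 1) * (‖z‖ ^ q + ‖w‖ ^ q))) := by
    have : Continuous fun ε : ℝ => (2 : ℝ) ^ (q - 1) * ((‖z‖ + ε) ^ q + (‖w‖ + ε) ^ q) := by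
      refine continuous_const.mul (Continuous.add ?_ ?_) <;>
        exact (continuous_const.add continuous_id).rpow_const fun _ => Or.inr hq.le
    have h := (this.tendsto 0).mono_left (nhdsWithin_le_nhds (s := Ioi 0))
    simpa using h
  refine ge_of_tendsto hlim ?_
  filter_upwards [self_mem_nhdsWithin] with ε hε
  have hε' : (0 : ℝ) < ε := hε
  obtain ⟨a, rfl, ha⟩ := hT.exists_preimage_norm_lt (show ‖z‖ < ‖z‖ + ε by linarith)
  obtain ⟨b, rfl, hb⟩ := hT.exists_preimage_norm_lt (show ‖w‖ < ‖w‖ + ε by linarith)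
  rw [← map_add, ← map_sub]
  calc ‖T (a + b)‖ ^ q + ‖T (a - b)‖ ^ q ≤ ‖a + b‖ ^ q + ‖a - b‖ ^ q := by
        gcongr <;> exact hT.norm_le _
    _ ≤ 2 ^ (q - 1) * (‖a‖ ^ q + ‖b‖ ^ q) := hA a b
    _ ≤ _ := by gcongr

end MetricQuotient

theorem Clarkson.of_isometry {q : ℝ} {A B : Type*} [SeminormedAddCommGroup A]
    [SeminormedAddCommGroup B] (hB : Clarkson q B) (f : A →+ B) (hf : ∀ a, ‖f a‖ = ‖a‖) :
    Clarkson q A := by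
  intro x y
  have := hB (f x) (f y)
  rwa [← map_add, ← map_sub, hf, hf, hf, hf] at this

theorem Clarkson.uniformConvexSpace {q : ℝ} (hq : 0 < q) {E : Type*} [SeminormedAddCommGroup E]
    (h : Clarkson q E) : UniformConvexSpace E := by
  refine ⟨fun ε hε => ?_⟩
  have h2q : (0 : ℝ) < 2 ^ q := by positivity
  have hεq : 0 < ε ^ q := by positivity
  -- For unit vectors Clarkson gives ‖x + y‖^q ≤ 2^q - ‖x - y‖^q. The maximum covers ε > 2, where
  -- the difference would be negative.
  set m : ℝ := max (2 ^ q - ε ^ q) 0 with hm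
  have hm0 : 0 ≤ m := le_max_right _ _
  have hm2 : m < 2 ^ q := max_lt (by linarith) h2q
  have hroot : m ^ q⁻¹ < 2 := by
    have := Real.rpow_lt_rpow hm0 hm2 (inv_pos.2 hq)
    rwa [Real.rpow_rpow_inv (by norm_num) hq.ne'] at this
  refine ⟨2 - m ^ q⁻¹, by linarith, fun x hx y hy hxy => ?_⟩
  have h1 := h x y
  rw [hx, hy, Real.one_rpow, show (1 : ℝ) + 1 = 2 by norm_num, Real.rpow_sub_one (by norm_num),
    div_mul_cancel₀ _ (by norm_num)] at h1
  have h3 : ε ^ q ≤ ‖x - y‖ ^ q := Real.rpow_le_rpow hε.le hxy hq.le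
  have h4 : ‖x + y‖ ^ q ≤ m := le_max_of_le_left (by linarith)
  have h5 := Real.rpow_le_rpow (by positivity) h4 (inv_nonneg.2 hq.le)
  rw [Real.rpow_rpow_inv (norm_nonneg _) hq.ne'] at h5
  linarith

/-! ### Goldstine's theorem and the Milman–Pettis theorem. -/

section MilmanPettis

variable {𝕜 : Type*} [RCLike 𝕜] {E : Type*} [NormedAddCommGroup E] [NormedSpace 𝕜 E]

/-- A unimodular factor turns f x into the real number ‖f x‖ without leaving the ball. -/
theorem norm_le_of_re_le {f : E →L[𝕜] 𝕜} {c : ℝ}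
    (h : ∀ x, ‖x‖ ≤ 1 → RCLike.re (f x) ≤ c) : ‖f‖ ≤ c := by
  refine le_of_forall_lt fun r hr => ?_
  obtain ⟨x, hx, hrx⟩ := f.exists_lt_apply_of_lt_opNorm hr
  obtain ⟨d, hd, hdx⟩ := RCLike.exists_norm_eq_mul_self (f x)
  have h1 := h (d • x) (by rw [norm_smul, hd, one_mul]; exact hx.le)
  rw [map_smul, smul_eq_mul, ← hdx, RCLike.ofReal_re] at h1
  exact hrx.trans_le h1

/-- Goldstine's theorem for finitely many functionals. -/
theorem mem_closure_image_closedBall (φ : StrongDual 𝕜 (StrongDual 𝕜 E)) (hφ : ‖φ‖ ≤ 1)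
    {ι : Type*} [Fintype ι] (f : ι → StrongDual 𝕜 E) :
    (fun i => φ (f i)) ∈ closure ((fun (x : E) i => f i x) '' Metric.closedBall 0 1) := by
  classical
  by_contra hmem
  let _ : NormedSpace ℝ E := NormedSpace.restrictScalars ℝ 𝕜 E
  have hconv : Convex ℝ ((fun (x : E) i => f i x) '' Metric.closedBall 0 1) := by
    refine (convex_closedBall (0 : E) 1).is_linear_image ⟨fun x y => ?_, fun c x => ?_⟩
    · ext i; simp
    · ext i
      change f i (c • x) = c • f i x
      rw [← algebraMap_smul 𝕜 c x, map_smul, algebraMap_smul]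
  -- The separating functional on 𝕜^ι is a combination of coordinates, so it comes from one
  -- functional g on E. The separation says re g ≤ u on the ball but re φ(g) > u, contradicting ‖φ‖
  -- ≤ 1.
  obtain ⟨L, u, hL, hu⟩ := RCLike.geometric_hahn_banach_closed_point (𝕜 := 𝕜) hconv.closure
    isClosed_closure hmem
  have hLsum : ∀ v : ι → 𝕜, L v = ∑ i, v i * L (Pi.single i 1) := by
    intro v
    conv_lhs => rw [pi_eq_sum_univ' v]
    simp [map_sum]
  let g : StrongDual 𝕜 E := ∑ i, L (Pi.single i 1) • f i
  have hg : ∀ x, g x = L (fun i => f i x) := by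
    intro x
    rw [hLsum]; simp [g, mul_comm]
  have hφg : φ g = L (fun i => φ (f i)) := by
    rw [hLsum]; simp [g, mul_comm]
  have hre : ∀ x : E, ‖x‖ ≤ 1 → RCLike.re (g x) ≤ u := fun x hx => by
    rw [hg]
    exact (hL _ (subset_closure ⟨x, by simpa using hx, rfl⟩)).le
  have hgn : ‖g‖ ≤ u := norm_le_of_re_le hre
  have : RCLike.re (φ g) ≤ u :=
    (RCLike.re_le_norm _).trans ((φ.le_opNorm g).trans
      ((mul_le_of_le_one_left (norm_nonneg _) hφ).trans hgn))
  rw [hφg] at this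
  linarith

/-- The Milman–Pettis theorem, in the unit ball. -/
theorem mem_range_inclusionInDoubleDual_of_norm_eq_one [CompleteSpace E] [UniformConvexSpace E]
    (φ : StrongDual 𝕜 (StrongDual 𝕜 E)) (hφ : ‖φ‖ = 1) :
    φ ∈ range (NormedSpace.inclusionInDoubleDual 𝕜 E) := by
  let _ : NormedSpace ℝ E := NormedSpace.restrictScalars ℝ 𝕜 E
  let ev : E → StrongDual 𝕜 E → 𝕜 := fun x f => f x
  -- A basic neighbourhood in the product topology sees finitely many functionals, so the finite
  -- version of Goldstine's theorem suffices.
  have hcl : (fun f => φ f) ∈ closure (ev '' Metric.closedBall 0 1) := by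
    rw [mem_closure_iff]
    intro o ho hφo
    obtain ⟨I, u, hu, hsub⟩ := isOpen_pi_iff.1 ho _ hφo
    have h1 := mem_closure_image_closedBall φ hφ.le (fun i : I => (i : StrongDual 𝕜 E))
    rw [mem_closure_iff] at h1
    obtain ⟨_, h2, x, hx, rfl⟩ := h1 (univ.pi fun i : I => u i)
      (isOpen_set_pi finite_univ fun i _ => (hu i i.2).1) (fun i _ => (hu i i.2).2)
    exact ⟨ev x, hsub fun i hi => h2 ⟨i, hi⟩ (mem_univ _), x, hx, rfl⟩
  obtain ⟨l, hl, hlφ⟩ := mapClusterPt_iff_ultrafilter.1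
    (show MapClusterPt (fun f => φ f) (𝓟 (Metric.closedBall 0 1)) ev by
      rwa [MapClusterPt, map_principal, ← mem_closure_iff_clusterPt])
  have hball : ∀ᶠ x in (l : Filter E), ‖x‖ ≤ 1 := by
    filter_upwards [hl (mem_principal_self _)] with x hx
    simpa using hx
  have hlim : ∀ f : StrongDual 𝕜 E, Tendsto (fun x => f x) l (𝓝 (φ f)) := fun f =>
    tendsto_pi_nhds.1 hlφ f
  -- Choose f in the unit ball with ‖φ f‖ > 1 - δ/4. If f x and f y are within δ/4 of φ f, then ‖x +
  -- y‖ > 2 - δ, and uniform convexity forces x and y to be ε-close.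
  have hcauchy : Cauchy (l : Filter E) := by
    rw [Metric.cauchy_iff]
    refine ⟨inferInstance, fun ε hε => ?_⟩
    obtain ⟨δ, hδ, hδ'⟩ := exists_forall_closed_ball_dist_add_le_two_sub E hε
    obtain ⟨f, hf, hfφ⟩ : ∃ f : StrongDual 𝕜 E, ‖f‖ ≤ 1 ∧ 1 - δ / 4 < ‖φ f‖ := by
      obtain ⟨f, hf, h⟩ := φ.exists_lt_apply_of_lt_opNorm (r := 1 - δ / 4) (by linarith)
      exact ⟨f, hf.le, h⟩
    have hnear := (Metric.tendsto_nhds.1 (hlim f)) (δ / 4) (by linarith)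
    refine ⟨_, hball.and hnear, fun x hx y hy => ?_⟩
    by_contra hxy
    rw [not_lt, dist_eq_norm] at hxy
    have h1 := hδ' hx.1 hy.1 hxy
    have h2 : ‖f (x + y)‖ ≤ ‖x + y‖ :=
      (f.le_opNorm _).trans (mul_le_of_le_one_left (norm_nonneg _) hf)
    have h3 : ‖φ f + φ f‖ ≤ ‖f (x + y)‖ + (‖f x - φ f‖ + ‖f y - φ f‖) := by
      have : φ f + φ f = f (x + y) - ((f x - φ f) + (f y - φ f)) := by rw [map_add]; ring
      rw [this]
      exact (norm_sub_le _ _).trans (by gcongr; exact norm_add_le _ _)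
    rw [← two_mul, norm_mul, RCLike.norm_two] at h3
    have h4 := hx.2
    have h5 := hy.2
    rw [dist_eq_norm] at h4 h5
    linarith
  obtain ⟨x, hx⟩ := CompleteSpace.complete hcauchy
  refine ⟨x, ?_⟩
  ext f
  exact tendsto_nhds_unique (((f.continuous.tendsto x).mono_left hx)) (hlim f)

set_option maxSynthPendingDepth 3 in
/-- **Milman–Pettis**: a uniformly convex Banach space is reflexive. -/
theorem surjective_inclusionInDoubleDual_of_uniformConvex [CompleteSpace E]
    [UniformConvexSpace E] : Function.Surjective (NormedSpace.inclusionInDoubleDual 𝕜 E) := by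
  intro φ
  rcases eq_or_ne φ 0 with rfl | h
  · exact ⟨0, map_zero _⟩
  have hn : ‖φ‖ ≠ 0 := norm_ne_zero_iff.2 h
  have hn' : (‖φ‖ : 𝕜) ≠ 0 := by exact_mod_cast hn
  obtain ⟨x, hx⟩ := mem_range_inclusionInDoubleDual_of_norm_eq_one (𝕜 := 𝕜)
    (((‖φ‖ : 𝕜))⁻¹ • φ) (by rw [norm_smul, norm_inv, RCLike.norm_ofReal, abs_norm,
      inv_mul_cancel₀ hn])
  exact ⟨(‖φ‖ : 𝕜) • x, by rw [map_smul, hx, smul_smul, mul_inv_cancel₀ hn', one_smul]⟩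

end MilmanPettis

end WillisSpace

namespace WillisSpace

/-! ### Clarkson's inequality for scalars and for L^p. -/

section ClarksonLp

variable {𝕜 : Type*} [RCLike 𝕜]

/-- With s = q/2 ≥ 1 and squared moduli, superadditivity of u ↦ u^s bounds the left side by the s-th
power of the parallelogram sum. Convexity of u ↦ u^s then splits this power, and the constants
combine to 2^s · 2^(s-1) = 2^(q-1). -/
theorem clarkson_rclike {q : ℝ} (hq : 2 ≤ q) : Clarkson q 𝕜 := by
  intro a b
  have hsq : ∀ t : ℝ, 0 ≤ t → (t ^ 2) ^ (q / 2) = t ^ q := fun t ht => by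
    rw [← Real.rpow_natCast, ← Real.rpow_mul ht]; congr 1; push_cast; ring
  have h1 : ‖a + b‖ ^ 2 + ‖a - b‖ ^ 2 = 2 * (‖a‖ ^ 2 + ‖b‖ ^ 2) := by
    simpa [sq] using parallelogram_law_with_norm 𝕜 a b
  have hq2 : 1 ≤ q / 2 := by linarith
  have h2 : (‖a‖ ^ 2 + ‖b‖ ^ 2) ^ (q / 2) ≤
      2 ^ (q / 2 - 1) * ((‖a‖ ^ 2) ^ (q / 2) + (‖b‖ ^ 2) ^ (q / 2)) := by
    have h := NNReal.coe_le_coe.2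
      (NNReal.rpow_add_le_mul_rpow_add_rpow (‖a‖₊ ^ 2 : NNReal) (‖b‖₊ ^ 2 : NNReal) hq2)
    push_cast at h
    exact h
  have h3 := Real.add_rpow_le_rpow_add (a := ‖a + b‖ ^ 2) (b := ‖a - b‖ ^ 2) (by positivity)
    (by positivity) hq2
  rw [hsq _ (norm_nonneg _), hsq _ (norm_nonneg _)] at h2 h3
  rw [h1, Real.mul_rpow (by norm_num) (by positivity)] at h3
  have h4 : (2 : ℝ) ^ (q / 2) * 2 ^ (q / 2 - 1) = 2 ^ (q - 1) := by
    rw [← Real.rpow_add (by norm_num)]; congr 1; ring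
  calc _ ≤ _ := h3
    _ ≤ 2 ^ (q / 2) * (2 ^ (q / 2 - 1) * (‖a‖ ^ q + ‖b‖ ^ q)) := by gcongr
    _ = _ := by rw [← mul_assoc, h4]

variable {α G : Type*} [MeasurableSpace α] {μ : Measure α} [NormedAddCommGroup G] {p : ℝ≥0∞}

theorem enorm_rpow_eq_lintegral (h0 : p ≠ 0) (hp : p ≠ ∞) (f : Lp G p μ) :
    ‖f‖ₑ ^ p.toReal = ∫⁻ x, ‖f x‖ₑ ^ p.toReal ∂μ := by
  rw [Lp.enorm_def, eLpNorm_eq_lintegral_rpow_enorm_toReal h0 hp, ← ENNReal.rpow_mul, one_div,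
    inv_mul_cancel₀ (ENNReal.toReal_pos h0 hp).ne', ENNReal.rpow_one]

theorem norm_rpow_eq_integral (h0 : p ≠ 0) (hp : p ≠ ∞) (f : Lp G p μ) :
    ‖f‖ ^ p.toReal = ∫ x, ‖f x‖ ^ p.toReal ∂μ := by
  have hq := ENNReal.toReal_pos h0 hp
  have hint : 0 ≤ ∫ x, ‖f x‖ ^ p.toReal ∂μ := integral_nonneg fun x => by positivity
  rw [Lp.norm_def, (Lp.memLp f).eLpNorm_eq_integral_rpow_norm h0 hp,
    ENNReal.toReal_ofReal (by positivity), Real.rpow_inv_rpow hint hq.ne']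

theorem Clarkson.lp (h0 : p ≠ 0) (hp : p ≠ ∞) (hG : Clarkson p.toReal G) [Fact (1 ≤ p)] :
    Clarkson p.toReal (Lp G p μ) := by
  intro f g
  simp only [norm_rpow_eq_integral h0 hp]
  have hi : ∀ u : Lp G p μ, Integrable (fun x => ‖u x‖ ^ p.toReal) μ := fun u =>
    (Lp.memLp u).integrable_norm_rpow h0 hp
  rw [← integral_add (hi _) (hi _), ← integral_add (hi _) (hi _), ← integral_const_mul]
  refine integral_mono_ae ((hi _).add (hi _)) (((hi _).add (hi _)).const_mul _) ?_
  filter_upwards [Lp.coeFn_add f g, Lp.coeFn_sub f g] with x h1 h2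
  rw [h1, h2]
  exact hG (f x) (g x)

end ClarksonLp

/-! ### Isometric embedding of L^p((0,1), Y) into L^p(0,1). -/

section Gluing

/-- The index `m` of the dyadic interval `(2^{-(m+1)}, 2^{-m}]` containing `x`. -/
noncomputable def dyadicIndex (x : ℝ) : ℕ := ⌊-Real.logb 2 x⌋₊

/-- The dyadic interval `(2^{-(m+1)}, 2^{-m}]`. -/
def dyadicIoc (m : ℕ) : Set ℝ := Ioc ((1 / 2 : ℝ) ^ (m + 1)) ((1 / 2 : ℝ) ^ m)

theorem mem_dyadicIoc_iff {x : ℝ} (hx : x ∈ Ioc (0 : ℝ) 1) {m : ℕ} :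
    x ∈ dyadicIoc m ↔ dyadicIndex x = m := by
  have hlog : 0 ≤ -Real.logb 2 x := by
    rw [neg_nonneg]; exact Real.logb_nonpos (by norm_num) hx.1.le hx.2
  have hpow : ∀ k : ℕ, (1 / 2 : ℝ) ^ k = 2 ^ (-(k : ℝ)) := fun k => by
    rw [Real.rpow_neg (by norm_num), Real.rpow_natCast, one_div, inv_pow]
  rw [dyadicIndex, Nat.floor_eq_iff hlog, dyadicIoc, mem_Ioc, hpow, hpow,
    ← Real.lt_logb_iff_rpow_lt (by norm_num) hx.1, ← Real.logb_le_iff_le_rpow (by norm_num) hx.1]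
  push_cast
  constructor <;> rintro ⟨h1, h2⟩ <;> constructor <;> linarith

theorem dyadicIoc_subset (m : ℕ) : dyadicIoc m ⊆ Ioc 0 1 := fun x hx =>
  ⟨lt_trans (by positivity) hx.1, hx.2.trans (pow_le_one₀ (by norm_num) (by norm_num))⟩

theorem iUnion_dyadicIoc : ⋃ m, dyadicIoc m = Ioc 0 1 := by
  refine Subset.antisymm (iUnion_subset dyadicIoc_subset) fun x hx => ?_
  exact mem_iUnion.2 ⟨_, (mem_dyadicIoc_iff hx).2 rfl⟩

theorem pairwise_disjoint_dyadicIoc : Pairwise (Function.onFun Disjoint dyadicIoc) := by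
  intro m n hmn
  refine Set.disjoint_left.2 fun x hm hn => hmn ?_
  have hx := dyadicIoc_subset m hm
  rw [← (mem_dyadicIoc_iff hx).1 hm, (mem_dyadicIoc_iff hx).1 hn]

theorem measurable_dyadicIndex : Measurable dyadicIndex :=
  Nat.measurable_floor.comp ((Real.measurable_log.div_const _).neg)

/-- Change of variables along the affine bijection x ↦ 2^(m+1) x - 1 of the m-th dyadic interval
onto (0,1]. -/
theorem lintegral_dyadicIoc (g : ℝ → ℝ≥0∞) (m : ℕ) :
    ∫⁻ x in dyadicIoc m, ENNReal.ofReal (2 ^ (m + 1)) * g (2 ^ (m + 1) * x - 1) =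
      ∫⁻ x in Ioc 0 1, g x := by
  have h2 : (0 : ℝ) < 2 ^ (m + 1) := by positivity
  have himg : (fun x : ℝ => 2 ^ (m + 1) * x - 1) '' dyadicIoc m = Ioc 0 1 := by
    ext y
    simp only [mem_image, dyadicIoc, mem_Ioc]
    have e1 : (2 : ℝ) ^ (m + 1) * (1 / 2) ^ (m + 1) = 1 := by rw [← mul_pow]; norm_num
    have e2 : (2 : ℝ) ^ (m + 1) * (1 / 2) ^ m = 2 := by
      rw [pow_succ, mul_right_comm, ← mul_pow]; norm_num
    constructor
    · rintro ⟨x, ⟨h1, h3⟩, rfl⟩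
      have h4 := mul_lt_mul_of_pos_left h1 h2
      have h5 := mul_le_mul_of_nonneg_left h3 h2.le
      constructor <;> linarith
    · rintro ⟨h1, h3⟩
      have e3 : (2 : ℝ) ^ (m + 1) * ((y + 1) / 2 ^ (m + 1)) = y + 1 := by field_simp
      refine ⟨(y + 1) / 2 ^ (m + 1), ⟨?_, ?_⟩, by rw [e3]; ring⟩
      · refine lt_of_mul_lt_mul_left ?_ h2.le
        rw [e1, e3]; linarith
      · refine le_of_mul_le_mul_left ?_ h2
        rw [e2, e3]; linarith
  rw [← himg, lintegral_image_eq_lintegral_abs_deriv_mul (s := dyadicIoc m)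
    (f' := fun _ => 2 ^ (m + 1)) measurableSet_Ioc]
  · simp only [abs_of_pos h2]
  · intro x _
    simpa using (((hasDerivAt_id x).const_mul ((2 : ℝ) ^ (m + 1))).sub_const 1).hasDerivWithinAt
  · intro x _ y _ h
    simpa using h

variable {𝕜 : Type*} [RCLike 𝕜] {Y : Type*} [NormedAddCommGroup Y] [NormedSpace 𝕜 Y]
  {p : ℝ≥0∞} {c : ℕ → Y →L[𝕜] 𝕜}

/-- Spread the coordinates `c m ∘ f` of `f : (0,1] → Y` over the dyadic intervals. -/
noncomputable def glue (p : ℝ≥0∞) (c : ℕ → Y →L[𝕜] 𝕜) (f : ℝ → Y) (x : ℝ) : 𝕜 :=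
  (((2 : ℝ) ^ ((dyadicIndex x + 1 : ℕ) / p.toReal) : ℝ) : 𝕜) *
    c (dyadicIndex x) (f (2 ^ (dyadicIndex x + 1) * x - 1))

/-- The index takes countably many values, so measurability for each fixed index gives joint
measurability on ℕ × ℝ. -/
theorem measurable_coordinate_comp {f : ℝ → Y} (hf : StronglyMeasurable f) (w : ℕ → 𝕜)
    (a : ℕ → ℝ) {i : ℝ → ℕ} (hi : Measurable i) :
    Measurable fun x => w (i x) * c (i x) (f (a (i x) * x - 1)) := by
  have hF : ∀ m : ℕ, Measurable fun x : ℝ => w m * c m (f (a m * x - 1)) := by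
    intro m
    have h1 : Measurable fun x : ℝ => a m * x - 1 := (measurable_id.const_mul _).sub_const _
    have h2 : StronglyMeasurable fun x : ℝ => f (a m * x - 1) := hf.comp_measurable h1
    exact ((c m).continuous.comp_stronglyMeasurable h2).measurable.const_mul _
  have hJ : Measurable fun z : ℕ × ℝ => w z.1 * c z.1 (f (a z.1 * z.2 - 1)) :=
    measurable_from_prod_countable_right hF
  exact hJ.comp (hi.prodMk measurable_id)

theorem measurable_glue {f : ℝ → Y} (hf : StronglyMeasurable f) : Measurable (glue p c f) :=
  measurable_coordinate_comp hf (fun m => (((2 : ℝ) ^ ((m + 1 : ℕ) / p.toReal) : ℝ) : 𝕜))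
    (fun m => 2 ^ (m + 1)) measurable_dyadicIndex

/-- The p-th power of the factor 2^((m+1)/p) in `glue` is the Jacobian 2^(m+1). Hence the m-th
interval contributes the integral of ‖c_m ∘ f‖^p, and Tonelli sums these to the integral of ‖f‖^p.
-/
theorem lintegral_glue (hp0 : 0 < p.toReal)
    (hc : ∀ y, ∑' m, ‖c m y‖ₑ ^ p.toReal = ‖y‖ₑ ^ p.toReal) {f : ℝ → Y}
    (hf : StronglyMeasurable f) :
    ∫⁻ x in Ioc 0 1, ‖glue p c f x‖ₑ ^ p.toReal = ∫⁻ x in Ioc 0 1, ‖f x‖ₑ ^ p.toReal := by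
  have hIoc : ∀ m, MeasurableSet (dyadicIoc m) := fun m => measurableSet_Ioc
  rw [← iUnion_dyadicIoc, lintegral_iUnion hIoc pairwise_disjoint_dyadicIoc, iUnion_dyadicIoc]
  simp_rw [← hc]
  rw [lintegral_tsum fun m => (((c m).continuous.comp_stronglyMeasurable
      hf).measurable.enorm.pow_const _).aemeasurable]
  congr 1
  ext m
  rw [← lintegral_dyadicIoc _ m]
  refine setLIntegral_congr_fun (hIoc m) fun x hx => ?_
  have hm := (mem_dyadicIoc_iff (dyadicIoc_subset m hx)).1 hx
  simp only [glue, hm]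
  rw [enorm_mul, ENNReal.mul_rpow_of_nonneg _ _ hp0.le]
  congr 1
  rw [← ofReal_norm, RCLike.norm_ofReal, abs_of_pos (by positivity),
    ENNReal.ofReal_rpow_of_nonneg (by positivity) hp0.le, ← Real.rpow_mul (by norm_num),
    div_mul_cancel₀ _ hp0.ne', Real.rpow_natCast]

theorem restrict_Ioo_eq_Ioc :
    (volume.restrict (Ioo (0 : ℝ) 1) : Measure ℝ) = volume.restrict (Ioc 0 1) :=
  restrict_Ioo_eq_restrict_Ioc

theorem eLpNorm_glue (h0 : p ≠ 0) (hp : p ≠ ∞)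
    (hc : ∀ y, ∑' m, ‖c m y‖ₑ ^ p.toReal = ‖y‖ₑ ^ p.toReal) {f : ℝ → Y}
    (hf : StronglyMeasurable f) :
    eLpNorm (glue p c f) p (volume.restrict (Ioo (0 : ℝ) 1)) =
      eLpNorm f p (volume.restrict (Ioo (0 : ℝ) 1)) := by
  rw [eLpNorm_eq_lintegral_rpow_enorm_toReal h0 hp, eLpNorm_eq_lintegral_rpow_enorm_toReal h0 hp,
    restrict_Ioo_eq_Ioc, lintegral_glue (ENNReal.toReal_pos h0 hp) hc hf]

/-- Applying norm preservation to f - g avoids following null sets through the affine maps. -/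
theorem glue_ae_eq (h0 : p ≠ 0) (hp : p ≠ ∞)
    (hc : ∀ y, ∑' m, ‖c m y‖ₑ ^ p.toReal = ‖y‖ₑ ^ p.toReal) {f g : ℝ → Y}
    (hf : StronglyMeasurable f) (hg : StronglyMeasurable g)
    (h : f =ᵐ[volume.restrict (Ioo (0 : ℝ) 1)] g) :
    glue p c f =ᵐ[volume.restrict (Ioo (0 : ℝ) 1)] glue p c g := by
  have h1 : eLpNorm (glue p c (f - g)) p (volume.restrict (Ioo (0 : ℝ) 1)) = 0 := by
    rw [eLpNorm_glue h0 hp hc (hf.sub hg), eLpNorm_congr_ae (g := 0), eLpNorm_zero]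
    filter_upwards [h] with x hx
    simp [hx]
  rw [eLpNorm_eq_zero_iff (measurable_glue (hf.sub hg)).aestronglyMeasurable h0] at h1
  filter_upwards [h1] with x hx
  simp only [glue, Pi.sub_apply, map_sub, mul_sub] at hx ⊢
  exact sub_eq_zero.1 hx

/-- `L^p((0,1), Y)` embeds isometrically into `L^p(0,1)` if the norm of `Y` is an `ℓ^p`-sum of
countably many coordinates. -/
theorem exists_linearIsometry_Lp [Fact (1 ≤ p)] (hp : p ≠ ∞)
    (hc : ∀ y, ∑' m, ‖c m y‖ₑ ^ p.toReal = ‖y‖ₑ ^ p.toReal) :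
    Nonempty (Lp Y p (volume.restrict (Ioo (0 : ℝ) 1)) →ₗᵢ[𝕜]
      Lp 𝕜 p (volume.restrict (Ioo (0 : ℝ) 1))) := by
  have h0 : p ≠ 0 := (zero_lt_one.trans_le (Fact.out : 1 ≤ p)).ne'
  have hmem : ∀ f : Lp Y p (volume.restrict (Ioo (0 : ℝ) 1)),
      MemLp (glue p c f) p (volume.restrict (Ioo (0 : ℝ) 1)) := fun f =>
    ⟨(measurable_glue (Lp.stronglyMeasurable f)).aestronglyMeasurable, by
      rw [eLpNorm_glue h0 hp hc (Lp.stronglyMeasurable f)]; exact (Lp.memLp f).2⟩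
  refine ⟨⟨⟨⟨fun f => (hmem f).toLp _, fun f g => ?_⟩, fun a f => ?_⟩, fun f => ?_⟩⟩
  · rw [← MemLp.toLp_add]
    refine MemLp.toLp_congr _ _ ?_
    refine (glue_ae_eq h0 hp hc (Lp.stronglyMeasurable _)
      ((Lp.stronglyMeasurable f).add (Lp.stronglyMeasurable g)) (Lp.coeFn_add f g)).trans
      (Eventually.of_forall fun x => ?_)
    simp [glue, mul_add]
  · change (hmem (a • f)).toLp _ = a • (hmem f).toLp _
    rw [← MemLp.toLp_const_smul]
    refine MemLp.toLp_congr _ _ ?_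
    refine (glue_ae_eq h0 hp hc (Lp.stronglyMeasurable _)
      ((Lp.stronglyMeasurable f).const_smul a) (Lp.coeFn_smul a f)).trans
      (Eventually.of_forall fun x => ?_)
    simp [glue, mul_left_comm]
  · change ‖(hmem f).toLp _‖ = ‖f‖
    rw [Lp.norm_toLp, eLpNorm_glue h0 hp hc (Lp.stronglyMeasurable f), Lp.norm_def]

end Gluing

/-! ### Scalar coordinates of the ℓ^p-sum. -/

section Coordinates

variable {𝕜 : Type*} [RCLike 𝕜] {p : ℝ≥0∞} [Fact (1 ≤ p)]

theorem enorm_rpow_eq_tsum {ι : Type*} {G : ι → Type*} [∀ i, NormedAddCommGroup (G i)]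
    (hp : 0 < p.toReal) (y : lp G p) : ‖y‖ₑ ^ p.toReal = ∑' k, ‖y k‖ₑ ^ p.toReal := by
  have hpow : ∀ {H : Type _} [NormedAddCommGroup H] (v : H),
      ‖v‖ₑ ^ p.toReal = ENNReal.ofReal (‖v‖ ^ p.toReal) := fun v => by
    rw [← ofReal_norm, ENNReal.ofReal_rpow_of_nonneg (norm_nonneg _) hp.le]
  have hpow' : ‖y‖ₑ ^ p.toReal = ENNReal.ofReal (‖y‖ ^ p.toReal) := by
    rw [← ofReal_norm, ENNReal.ofReal_rpow_of_nonneg (norm_nonneg _) hp.le]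
  rw [hpow', lp.norm_rpow_eq_tsum hp]
  exact (ENNReal.ofReal_tsum_of_nonneg (fun _ => by positivity)
    ((lp.memℓp y).summable hp)).trans (tsum_congr fun k => (hpow (y k)).symm)

/-- The coordinates are the entries (k, j), the j-th scalar of the k-th summand, enumerated by the
pairing of ℕ × ℕ with ℕ. -/
theorem exists_coordinates (hp : p ≠ ∞) {X : Submodule 𝕜 (lp (fun _ : ℕ => 𝕜) p)}
    (F : ℕ → Submodule 𝕜 X) :
    ∃ c : ℕ → lp (fun k => F k) p →L[𝕜] 𝕜,
      ∀ y, ∑' m, ‖c m y‖ₑ ^ p.toReal = ‖y‖ₑ ^ p.toReal := by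
  have hp0 : 0 < p.toReal :=
    ENNReal.toReal_pos (zero_lt_one.trans_le (Fact.out : 1 ≤ p)).ne' hp
  let d : ℕ × ℕ → lp (fun k => F k) p →L[𝕜] 𝕜 := fun i =>
    (lp.evalCLM 𝕜 (fun _ : ℕ => 𝕜) p i.2).comp (X.subtypeL.comp ((F i.1).subtypeL.comp
      (lp.evalCLM 𝕜 (fun k => F k) p i.1)))
  refine ⟨fun m => d (Nat.pairEquiv.symm m), fun y => ?_⟩
  rw [Nat.pairEquiv.symm.tsum_eq fun i => ‖d i y‖ₑ ^ p.toReal, 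
    ENNReal.tsum_prod (f := fun k j => ‖d (k, j) y‖ₑ ^ p.toReal), enorm_rpow_eq_tsum hp0]
  refine tsum_congr fun k => ?_
  exact (enorm_rpow_eq_tsum hp0 (((y k : F k) : X) : lp (fun _ : ℕ => 𝕜) p)).symm

end Coordinates

end WillisSpace

namespace WillisSpace

/-! ### Bounded convergence in L^p. -/

section BoundedConvergence

variable {α G : Type*} [MeasurableSpace α] {μ : Measure α} [IsFiniteMeasure μ]
  [NormedAddCommGroup G] {p : ℝ≥0∞}

theorem tendsto_eLpNorm_zero_of_bounded (h0 : p ≠ 0) (hp : p ≠ ∞) {f : ℕ → α → G} {C : ℝ}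
    (hf : ∀ n, AEStronglyMeasurable (f n) μ) (hC : ∀ n, ∀ᵐ x ∂μ, ‖f n x‖ ≤ C)
    (hlim : ∀ᵐ x ∂μ, Tendsto (fun n => f n x) atTop (𝓝 0)) :
    Tendsto (fun n => eLpNorm (f n) p μ) atTop (𝓝 0) := by
  have hq := ENNReal.toReal_pos h0 hp
  simp_rw [eLpNorm_eq_lintegral_rpow_enorm_toReal h0 hp]
  have h1 : Tendsto (fun n => ∫⁻ x, ‖f n x‖ₑ ^ p.toReal ∂μ) atTop (𝓝 (∫⁻ _, 0 ∂μ)) := by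
    refine tendsto_lintegral_of_dominated_convergence' (fun _ => ENNReal.ofReal C ^ p.toReal)
      (fun n => (hf n).enorm.pow_const _) (fun n => ?_) ?_ ?_
    · filter_upwards [hC n] with x hx
      rw [← ofReal_norm]
      exact ENNReal.rpow_le_rpow (ENNReal.ofReal_le_ofReal hx) hq.le
    · rw [lintegral_const]
      exact ENNReal.mul_ne_top (ENNReal.rpow_ne_top_of_nonneg hq.le ENNReal.ofReal_ne_top)
        (measure_ne_top _ _)
    · filter_upwards [hlim] with x hx
      have h2 := (ENNReal.continuous_rpow_const (y := p.toReal)).tendsto _ |>.comp hx.enorm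
      simpa [Function.comp_def, ENNReal.zero_rpow_of_pos hq] using h2
  have h3 := (ENNReal.continuous_rpow_const (y := 1 / p.toReal)).tendsto _ |>.comp h1
  simpa [Function.comp_def, ENNReal.zero_rpow_of_pos (inv_pos.2 hq)] using h3

end BoundedConvergence

variable {𝕜 : Type*} [RCLike 𝕜] {E : Type*} [NormedAddCommGroup E] [NormedSpace 𝕜 E]
  {p : ℝ≥0∞} [Fact (1 ≤ p)] [Fact (p ≠ ∞)] {F : ℕ → Submodule 𝕜 E}

/-! ### Transport of lifts between parameters. -/

section Damp

/-- Truncating h at 0 makes the damping a contraction for every real h. -/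
theorem damp_coeff_le_one (h : ℝ) (k : ℕ) : (1 / 2 : ℝ) ^ (max h 0 * k) ≤ 1 :=
  Real.rpow_le_one (by norm_num) (by norm_num) (by positivity)

theorem norm_damp_coeff_smul_le (h : ℝ) (y : lp (fun k => F k) p) (k : ℕ) :
    ‖(((1 / 2 : ℝ) ^ (max h 0 * k) : ℝ) : 𝕜) • y k‖ ≤ ‖y k‖ := by
  rw [norm_smul, RCLike.norm_ofReal, abs_of_nonneg (by positivity)]
  exact mul_le_of_le_one_left (norm_nonneg _) (damp_coeff_le_one h k)

/-- The contraction multiplying the `k`-th coordinate by `(1/2)^{hk}` (for `h ≥ 0`). -/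
noncomputable def damp (h : ℝ) (y : lp (fun k => F k) p) : lp (fun k => F k) p :=
  ⟨fun k => (((1 / 2 : ℝ) ^ (max h 0 * k) : ℝ) : 𝕜) • y k, memℓp_gen <|
    Summable.of_nonneg_of_le (fun k => by positivity)
      (fun k => Real.rpow_le_rpow (norm_nonneg _) (norm_damp_coeff_smul_le h y k)
        (toReal_pos' p).le) ((lp.memℓp y).summable (toReal_pos' p))⟩

theorem damp_apply (h : ℝ) (y : lp (fun k => F k) p) (k : ℕ) :
    damp h y k = (((1 / 2 : ℝ) ^ (max h 0 * k) : ℝ) : 𝕜) • y k := rfl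

theorem norm_damp_le (h : ℝ) (y : lp (fun k => F k) p) : ‖damp h y‖ ≤ ‖y‖ :=
  lp.norm_mono (zero_lt_one.trans_le (Fact.out : 1 ≤ p)).ne' (norm_damp_coeff_smul_le h y)

theorem damp_sub (h : ℝ) (y z : lp (fun k => F k) p) :
    damp h (y - z) = damp h y - damp h z := by
  refine lp.ext (funext fun k => ?_)
  rw [lp.coeFn_sub, Pi.sub_apply, damp_apply, damp_apply, damp_apply, lp.coeFn_sub, Pi.sub_apply,
    smul_sub]

theorem damp_zero (h : ℝ) : damp h (0 : lp (fun k => F k) p) = 0 := by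
  refine lp.ext (funext fun k => ?_)
  rw [damp_apply, lp.coeFn_zero, Pi.zero_apply, smul_zero]

theorem zero_damp (y : lp (fun k => F k) p) : damp 0 y = y := by
  refine lp.ext (funext fun k => ?_)
  rw [damp_apply, max_self, zero_mul, Real.rpow_zero, RCLike.ofReal_one, one_smul]

/-- The exponents add up: (1 - t) + (t - s) = 1 - s. -/
theorem IsSum.damp {s t : ℝ} (hst : s ≤ t) {y : lp (fun k => F k) p} {w : E}
    (h : IsSum p F s y w) : IsSum p F t (damp (t - s) y) w := by
  unfold IsSum at h ⊢
  convert! h using 2 with k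
  rw [damp_apply, Submodule.coe_smul, smul_smul, max_eq_left (by linarith), ← RCLike.ofReal_mul,
    ← Real.rpow_add (by norm_num)]
  congr 3
  ring

/-- Dominated convergence: two damping coefficients differ by at most 1, so ‖y k‖^p is a summable
bound. -/
theorem continuous_damp (y : lp (fun k => F k) p) : Continuous fun h => damp h y := by
  have hq := toReal_pos' p
  refine continuous_iff_continuousAt.2 fun h₀ => ?_
  have hc : ∀ k : ℕ, Continuous fun h : ℝ => (1 / 2 : ℝ) ^ (max h 0 * k) := fun k =>
    continuous_const.rpow ((continuous_id.max continuous_const).mul continuous_const)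
      fun _ => Or.inl (by norm_num)
  have hk : ∀ h k, ‖(damp h y - damp h₀ y) k‖ =
      |(1 / 2 : ℝ) ^ (max h 0 * k) - (1 / 2 : ℝ) ^ (max h₀ 0 * k)| * ‖y k‖ := fun h k => by
    rw [lp.coeFn_sub, Pi.sub_apply, damp_apply, damp_apply, ← sub_smul, ← RCLike.ofReal_sub,
      norm_smul, RCLike.norm_ofReal]
  have hpow : Tendsto (fun h => ‖damp h y - damp h₀ y‖ ^ p.toReal) (𝓝 h₀) (𝓝 0) := by
    simp_rw [lp.norm_rpow_eq_tsum hq]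
    rw [← tsum_zero (α := ℝ) (β := ℕ)]
    refine tendsto_tsum_of_dominated_convergence (bound := fun k => ‖y k‖ ^ p.toReal)
      ((lp.memℓp y).summable hq) (fun k => ?_) (Eventually.of_forall fun h k => ?_)
    · simp_rw [hk]
      have h1 : Continuous fun h : ℝ => (|(1 / 2 : ℝ) ^ (max h 0 * k) -
          (1 / 2 : ℝ) ^ (max h₀ 0 * k)| * ‖y k‖) ^ p.toReal :=
        (((hc k).sub continuous_const).abs.mul continuous_const).rpow_const
          fun _ => Or.inr hq.le
      simpa [Real.zero_rpow hq.ne'] using h1.tendsto h₀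
    · rw [Real.norm_of_nonneg (by positivity), hk]
      refine Real.rpow_le_rpow (by positivity) ?_ hq.le
      refine mul_le_of_le_one_left (norm_nonneg _) ?_
      have h1 := damp_coeff_le_one h k
      have h2 := damp_coeff_le_one h₀ k
      have h3 : (0 : ℝ) ≤ (1 / 2 : ℝ) ^ (max h 0 * k) := by positivity
      have h4 : (0 : ℝ) ≤ (1 / 2 : ℝ) ^ (max h₀ 0 * k) := by positivity
      rw [abs_le]; constructor <;> linarith
  rw [ContinuousAt, tendsto_iff_norm_sub_tendsto_zero]
  have h5 := hpow.rpow_const (p := p.toReal⁻¹) (Or.inr (inv_pos.2 hq).le)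
  rw [Real.zero_rpow (inv_pos.2 hq).ne'] at h5
  exact h5.congr fun h => Real.rpow_rpow_inv (norm_nonneg _) hq.ne'

theorem isSum_fiberQuot [CompleteSpace E] {t : ℝ} (ht : t < 1) (y : lp (fun k => F k) p) :
    IsSum p F t y (fiberQuot p F t y) := by
  refine Summable.hasSum (Summable.of_norm_bounded (g := fun k : ℕ =>
    ((1 / 2 : ℝ) ^ (1 - t)) ^ k * ‖y‖) (Summable.mul_right _ ?_) fun k => ?_)
  · exact summable_geometric_of_lt_one (by positivity)
      (Real.rpow_lt_one (by norm_num) (by norm_num) (by linarith))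
  · rw [norm_smul, RCLike.norm_ofReal, abs_of_nonneg (by positivity),
      Real.rpow_mul (by norm_num), Real.rpow_natCast]
    gcongr
    exact lp.norm_apply_le_norm (zero_lt_one.trans_le (Fact.out : 1 ≤ p)).ne' y k

end Damp

/-! ### Grid step functions and their lifts. -/

section Grid

/-- The open cells of the grid of mesh `1/n`. -/
def gridCell (n j : ℕ) : Set ℝ := Ioo ((j : ℝ) / n) ((j + 1 : ℝ) / n)

theorem gridCell_unique {n i j : ℕ} {r : ℝ} (hi : r ∈ gridCell n i) (hj : r ∈ gridCell n j) :
    i = j := by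
  have hn : (0 : ℝ) < n := by
    rcases (Nat.cast_nonneg (α := ℝ) n).eq_or_lt with h | h
    · have h2 := hi.1.trans hi.2
      rw [← h] at h2; simp at h2
    · exact h
  have h1 := hi.1.trans hj.2
  have h2 := hj.1.trans hi.2
  rw [div_lt_div_iff_of_pos_right hn] at h1 h2
  have h3 : i < j + 1 := by exact_mod_cast h1
  have h4 : j < i + 1 := by exact_mod_cast h2
  omega

/-- Irrational points avoid the endpoints of every grid, so one null set serves all n. -/
theorem exists_mem_gridCell {n : ℕ} (hn : 0 < n) {r : ℝ} (hr : Irrational r) (hr0 : 0 < r) :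
    ∃ i, r ∈ gridCell n i := by
  have hn' : (0 : ℝ) < n := by exact_mod_cast hn
  refine ⟨⌊r * n⌋₊, ?_, ?_⟩
  · rw [div_lt_iff₀ hn']
    refine lt_of_le_of_ne (Nat.floor_le (by positivity)) fun h => ?_
    exact ((hr.mul_natCast hn.ne').ne_nat _) h.symm
  · rw [lt_div_iff₀ hn']
    exact Nat.lt_floor_add_one _

theorem ae_irrational : ∀ᵐ r : ℝ, Irrational r :=
  (Set.countable_range ((↑) : ℚ → ℝ)).ae_notMem volume

theorem sum_indicator_gridCell {V : Type*} [AddCommMonoid V] (S : Finset ℕ) {n i : ℕ}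
    (g : ℕ → ℝ → V) {r : ℝ} (hr : r ∈ gridCell n i) :
    ∑ j ∈ S, (gridCell n j).indicator (g j) r = if i ∈ S then g i r else 0 := by
  split_ifs with h
  · rw [Finset.sum_eq_single_of_mem i h, indicator_of_mem hr]
    intro j _ hj
    exact indicator_of_notMem (fun hrj => hj (gridCell_unique hrj hr)) _
  · refine Finset.sum_eq_zero fun j hj => indicator_of_notMem (fun hrj => h ?_) _
    rwa [gridCell_unique hr hrj]

/-- The function `r ↦ damp (r - j/n) (y j)` on the `j`-th cell, for the cells with closure in
`(0,1)`. -/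
noncomputable def gridLift (n : ℕ) (y : ℕ → lp (fun k => F k) p) (r : ℝ) : lp (fun k => F k) p :=
  ∑ j ∈ Finset.Ico 1 (n - 1), (gridCell n j).indicator (fun r => damp (r - j / n) (y j)) r

theorem aestronglyMeasurable_gridLift (n : ℕ) (y : ℕ → lp (fun k => F k) p) {μ : Measure ℝ} :
    AEStronglyMeasurable (gridLift n y) μ := by
  refine Finset.aestronglyMeasurable_fun_sum _ fun j _ => ?_
  have hc : Continuous fun r : ℝ => damp (r - j / n) (y j) :=
    (continuous_damp (y j)).comp (continuous_id.sub continuous_const)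
  exact hc.aestronglyMeasurable.indicator measurableSet_Ioo

theorem memLp_gridLift (n : ℕ) (y : ℕ → lp (fun k => F k) p) :
    MemLp (gridLift n y) p (volume.restrict (Ioo (0 : ℝ) 1)) := by
  refine MemLp.of_bound (aestronglyMeasurable_gridLift n y)
    (∑ j ∈ Finset.Ico 1 (n - 1), ‖y j‖) (Eventually.of_forall fun r => ?_)
  refine (norm_sum_le _ _).trans (Finset.sum_le_sum fun j _ => ?_)
  exact (norm_indicator_le_norm_self _ _).trans (norm_damp_le _ _)

/-- The step function with value `Q_{j/n} (y j)` on the `j`-th cell. -/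
noncomputable def gridStep [CompleteSpace E] (n : ℕ) (y : ℕ → lp (fun k => F k) p) :
    StepSpace p F :=
  ⟨∑ j ∈ Finset.Ico 1 (n - 1), (gridCell n j).indicator
    (fun _ => fiberQuot p F ((j : ℝ) / n) (y j)), by
    refine Submodule.sum_mem _ fun j hj => Submodule.subset_span ?_
    rw [Finset.mem_Ico] at hj
    have hn : (0 : ℝ) < n := by exact_mod_cast (by omega : 0 < n)
    have h1 : (1 : ℝ) ≤ j := by exact_mod_cast hj.1
    have h2 : (j : ℝ) + 1 < n := by exact_mod_cast (by omega : j + 1 < n)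
    refine ⟨(j : ℝ) / n, (j + 1 : ℝ) / n, _, by positivity, ?_, ?_, ?_, rfl⟩
    · gcongr; linarith
    · rwa [div_lt_one hn]
    · have : (j : ℝ) / n < 1 := by rw [div_lt_one hn]; linarith
      exact (mem_fiber_iff this).2 ⟨_, isSum_fiberQuot this _⟩⟩

theorem gridStep_apply [CompleteSpace E] (n : ℕ) (y : ℕ → lp (fun k => F k) p) (r : ℝ) :
    (gridStep n y).toFun r = ∑ j ∈ Finset.Ico 1 (n - 1), (gridCell n j).indicator
      (fun _ => fiberQuot p F ((j : ℝ) / n) (y j)) r := by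
  change (∑ j ∈ Finset.Ico 1 (n - 1), (gridCell n j).indicator
    (fun _ => fiberQuot p F ((j : ℝ) / n) (y j))) r = _
  rw [Finset.sum_apply]

end Grid

/-! ### Liftings of step functions. -/

section Lifts

/-- `f` is a lifting of the step function `u`: almost everywhere `Q_r (f r) = u r`. -/
def Lifts (f : ℝ → lp (fun k => F k) p) (u : StepSpace p F) : Prop :=
  ∀ᵐ r ∂volume.restrict (Ioo (0 : ℝ) 1), IsSum p F r (f r) (u.toFun r)

theorem Lifts.congr {f g : ℝ → lp (fun k => F k) p} {u : StepSpace p F} (h : Lifts f u)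
    (hfg : f =ᵐ[volume.restrict (Ioo (0 : ℝ) 1)] g) : Lifts g u := by
  filter_upwards [h, hfg] with r h1 h2
  rwa [← h2]

theorem Lifts.add {f g : ℝ → lp (fun k => F k) p} {u v : StepSpace p F} (hf : Lifts f u)
    (hg : Lifts g v) : Lifts (f + g) (u + v) := by
  filter_upwards [hf, hg] with r h1 h2
  exact IsSum.add h1 h2

theorem Lifts.smul {f : ℝ → lp (fun k => F k) p} {u : StepSpace p F} (c : 𝕜) (hf : Lifts f u) :
    Lifts (c • f) (c • u) := by
  filter_upwards [hf] with r h1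
  exact h1.smul c

theorem lifts_zero : Lifts (0 : ℝ → lp (fun k => F k) p) (0 : StepSpace p F) :=
  Eventually.of_forall fun r => isSum_zero r

theorem Lifts.sub {f g : ℝ → lp (fun k => F k) p} {u v : StepSpace p F} (hf : Lifts f u)
    (hg : Lifts g v) : Lifts (f - g) (u - v) := by
  have h := hf.add (hg.smul (-1 : 𝕜))
  rwa [neg_one_smul, neg_one_smul, ← sub_eq_add_neg, ← sub_eq_add_neg] at h

theorem norm_eq_eLpNorm (u : StepSpace p F) :
    ‖u‖ = (eLpNorm (fun r => fiberNorm p F r (u.toFun r)) p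
      (volume.restrict (Ioo (0 : ℝ) 1))).toReal := stepNorm_eq u

theorem Lifts.norm_le {f : ℝ → lp (fun k => F k) p} {u : StepSpace p F} (h : Lifts f u)
    (hf : MemLp f p (volume.restrict (Ioo (0 : ℝ) 1))) :
    ‖u‖ ≤ (eLpNorm f p (volume.restrict (Ioo (0 : ℝ) 1))).toReal := by
  rw [norm_eq_eLpNorm]
  refine ENNReal.toReal_mono hf.2.ne (eLpNorm_mono_ae ?_)
  filter_upwards [h, ae_restrict_mem measurableSet_Ioo] with r h1 hr
  rw [Real.norm_of_nonneg (fiberNorm_nonneg r _)]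
  exact fiberNorm_le hr.2 h1

theorem Lifts.norm_le_Lp {f : Lp (lp (fun k => F k) p) p (volume.restrict (Ioo (0 : ℝ) 1))}
    {u : StepSpace p F} (h : Lifts f u) : ‖u‖ ≤ ‖f‖ := by
  rw [Lp.norm_def]
  exact h.norm_le (Lp.memLp f)

theorem lifts_gridLift [CompleteSpace E] (n : ℕ) (y : ℕ → lp (fun k => F k) p) :
    Lifts (gridLift n y) (gridStep n y) := by
  filter_upwards [ae_restrict_of_ae ae_irrational, ae_restrict_mem measurableSet_Ioo] with r hir hr
  rcases Nat.eq_zero_or_pos n with rfl | hn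
  · simpa [gridLift, gridStep_apply] using isSum_zero r
  obtain ⟨i, hi⟩ := exists_mem_gridCell hn hir hr.1
  rw [gridStep_apply, gridLift, sum_indicator_gridCell _ _ hi, sum_indicator_gridCell _ _ hi]
  split_ifs with h
  · exact (isSum_fiberQuot (hi.1.trans hr.2) (y i)).damp hi.1.le
  · exact isSum_zero r

end Lifts

end WillisSpace

namespace WillisSpace

variable {𝕜 : Type*} [RCLike 𝕜] {E : Type*} [NormedAddCommGroup E] [NormedSpace 𝕜 E]
  {p : ℝ≥0∞} [Fact (1 ≤ p)] [Fact (p ≠ ∞)] {F : ℕ → Submodule 𝕜 E}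

/-! ### Density of the liftable functions. -/

section Density

theorem Ico_grid_mem {n i : ℕ} {r : ℝ} (hi : r ∈ gridCell n i) (hn : (0 : ℝ) < n)
    (h1 : 2 / n < r) (h2 : r < 1 - 2 / n) : i ∈ Finset.Ico 1 (n - 1) := by
  rw [Finset.mem_Ico]
  have h3 := h1.trans hi.2
  have h4 := hi.1.trans h2
  rw [div_lt_div_iff_of_pos_right hn] at h3
  have h5 : (i : ℝ) + 2 < n := by
    have : ((i : ℝ) + 2) / n < 1 := by rw [add_div]; linarith
    rwa [div_lt_one hn] at this
  have h6 : 2 < i + 1 := by exact_mod_cast h3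
  have h7 : i + 2 < n := by exact_mod_cast h5
  omega

theorem tendsto_two_div : Tendsto (fun n : ℕ => (2 : ℝ) / n) atTop (𝓝 0) :=
  tendsto_const_div_atTop_nhds_zero_nat 2

theorem gridCell_dist {n i : ℕ} {r : ℝ} (hi : r ∈ gridCell n i) : 0 < r - i / n ∧
    r - i / n < 1 / n := by
  have h1 := hi.1
  have h2 := hi.2
  rw [add_div] at h2
  constructor <;> linarith

/-- Replacing g(i/n) by g(r) costs at most ‖g(i/n) - g(r)‖, since damping contracts; the damping
parameter r - i/n tends to 0. -/
theorem tendsto_gridLift_comp {g : ℝ → lp (fun k => F k) p} (hg : Continuous g) {r : ℝ}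
    (hr : r ∈ Ioo (0 : ℝ) 1) (hir : Irrational r) :
    Tendsto (fun n : ℕ => gridLift n (fun j => g (j / n)) r) atTop (𝓝 (g r)) := by
  have hex : ∀ n : ℕ, ∃ i : ℕ, 0 < n → r ∈ gridCell n i := fun n => by
    rcases Nat.eq_zero_or_pos n with h | h
    · exact ⟨0, fun h' => absurd h h'.ne'⟩
    · exact (exists_mem_gridCell h hir hr.1).imp fun i hi _ => hi
  choose i hi using hex
  have hlim0 : Tendsto (fun n : ℕ => r - i n / n) atTop (𝓝 0) := by
    refine squeeze_zero' (g := fun n : ℕ => 1 / (n : ℝ)) ?_ ?_ tendsto_one_div_atTop_nhds_zero_nat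
    · filter_upwards [eventually_gt_atTop 0] with n hn using (gridCell_dist (hi n hn)).1.le
    · filter_upwards [eventually_gt_atTop 0] with n hn using (gridCell_dist (hi n hn)).2.le
  have hlimr : Tendsto (fun n : ℕ => (i n : ℝ) / n) atTop (𝓝 r) := by
    simpa using hlim0.const_sub r
  have h1 : Tendsto (fun n : ℕ => damp (r - i n / n) (g (i n / n)) - damp (r - i n / n) (g r))
      atTop (𝓝 0) := by
    refine squeeze_zero_norm (fun n => ?_) (tendsto_iff_norm_sub_tendsto_zero.1
      ((hg.tendsto r).comp hlimr))
    rw [← damp_sub]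
    exact norm_damp_le _ _
  have h2 : Tendsto (fun n : ℕ => damp (r - i n / n) (g r)) atTop (𝓝 (g r)) := by
    have := ((continuous_damp (g r)).tendsto 0).comp hlim0
    rwa [zero_damp] at this
  have h3 := h1.add h2
  rw [zero_add] at h3
  refine h3.congr' ?_
  filter_upwards [eventually_gt_atTop 0, tendsto_two_div.eventually (gt_mem_nhds hr.1),
    tendsto_two_div.eventually (gt_mem_nhds (show 0 < 1 - r by linarith [hr.2]))] with n hn ha hb
  rw [gridLift, sum_indicator_gridCell _ _ (hi n hn),
    if_pos (Ico_grid_mem (hi n hn) (by exact_mod_cast hn) ha (by linarith)), sub_add_cancel]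

theorem norm_gridLift_le {n : ℕ} {y : ℕ → lp (fun k => F k) p} {C : ℝ} (hC : ∀ j, ‖y j‖ ≤ C)
    (r : ℝ) : ‖gridLift n y r‖ ≤ C := by
  have hC0 : 0 ≤ C := (norm_nonneg _).trans (hC 0)
  by_cases h : ∃ i, r ∈ gridCell n i
  · obtain ⟨i, hi⟩ := h
    rw [gridLift, sum_indicator_gridCell _ _ hi]
    split_ifs
    · exact (norm_damp_le _ _).trans (hC i)
    · simpa using hC0
  · rw [gridLift, Finset.sum_eq_zero fun j _ => indicator_of_notMem (fun hj => h ⟨j, hj⟩) _]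
    simpa using hC0

/-- Approximate f by a bounded continuous g. Its grid samples, damped along the cells, lift step
functions and converge boundedly to g. -/
theorem exists_lifts_near [CompleteSpace E]
    (f : Lp (lp (fun k => F k) p) p (volume.restrict (Ioo (0 : ℝ) 1))) {ε : ℝ} (hε : 0 < ε) :
    ∃ (g : Lp (lp (fun k => F k) p) p (volume.restrict (Ioo (0 : ℝ) 1))) (u : StepSpace p F),
      Lifts g u ∧ ‖f - g‖ < ε := by
  have h0 : p ≠ 0 := (zero_lt_one.trans_le (Fact.out : 1 ≤ p)).ne'
  have hp : p ≠ ∞ := Fact.out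
  let _ : NormedSpace ℝ (lp (fun k => F k) p) := NormedSpace.restrictScalars ℝ 𝕜 _
  obtain ⟨g, hfg, hg⟩ := (Lp.memLp f).exists_boundedContinuous_eLpNorm_sub_le hp
    (ε := ENNReal.ofReal (ε / 2)) (by simpa using hε)
  have hlim : Tendsto (fun n : ℕ => eLpNorm (fun r => g r - gridLift n (fun j => g (j / n)) r) p
      (volume.restrict (Ioo (0 : ℝ) 1))) atTop (𝓝 0) := by
    refine tendsto_eLpNorm_zero_of_bounded h0 hp (C := ‖g‖ + ‖g‖)
      (fun n => hg.1.sub (aestronglyMeasurable_gridLift n _)) (fun n => ?_) ?_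
    · refine Eventually.of_forall fun r => (norm_sub_le _ _).trans ?_
      exact add_le_add (g.norm_coe_le_norm r) (norm_gridLift_le (fun j => g.norm_coe_le_norm _) r)
    · filter_upwards [ae_restrict_of_ae ae_irrational, ae_restrict_mem measurableSet_Ioo]
        with r hir hr
      simpa using (tendsto_gridLift_comp g.continuous hr hir).const_sub (g r)
  obtain ⟨n, hn⟩ := (hlim.eventually (gt_mem_nhds
    (show (0 : ℝ≥0∞) < ENNReal.ofReal (ε / 2) by simpa using hε))).exists
  have hmem := memLp_gridLift n (fun j => g (j / n))
  refine ⟨hmem.toLp _, gridStep n (fun j => g (j / n)),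
    (lifts_gridLift n _).congr hmem.coeFn_toLp.symm, ?_⟩
  have h1 : eLpNorm (⇑f - gridLift n (fun j => g (j / n))) p (volume.restrict (Ioo (0 : ℝ) 1)) <
      ENNReal.ofReal ε := by
    have h2 : (⇑f - gridLift n (fun j => g (j / n))) =
        (⇑f - ⇑g) + fun r => g r - gridLift n (fun j => g (j / n)) r := by
      ext1 r; simp
    rw [h2]
    refine (eLpNorm_add_le ((Lp.memLp f).1.sub hg.1) (hg.1.sub hmem.1) Fact.out).trans_lt ?_
    refine (ENNReal.add_lt_add_of_le_of_lt (hfg.trans_lt ENNReal.ofReal_lt_top).ne hfg hn).trans_le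
      ?_
    rw [← ENNReal.ofReal_add (by linarith) (by linarith), add_halves]
  have h3 : f - hmem.toLp _ = ((Lp.memLp f).sub hmem).toLp _ := by
    rw [MemLp.toLp_sub (Lp.memLp f) hmem, Lp.toLp_coeFn f (Lp.memLp f)]
  rw [h3, Lp.norm_toLp]
  exact (ENNReal.toReal_lt_of_lt_ofReal h1)

end Density

/-! ### Almost optimal lifts of step functions. -/

section NearOptimal

theorem StepSpace.sub_toFun (u v : StepSpace p F) (r : ℝ) :
    (u - v).toFun r = u.toFun r - v.toFun r := rfl

/-- Liftings of a step function that are almost optimal, up to a small error. -/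
theorem exists_lifts_norm_le [CompleteSpace E] (u : StepSpace p F) {ε : ℝ} (hε : 0 < ε) :
    ∃ (f : Lp (lp (fun k => F k) p) p (volume.restrict (Ioo (0 : ℝ) 1))) (v : StepSpace p F),
      Lifts f v ∧ ‖f‖ ≤ ‖u‖ + ε ∧ ‖u - v‖ ≤ ε := by
  classical
  have h0 : p ≠ 0 := (zero_lt_one.trans_le (Fact.out : 1 ≤ p)).ne'
  have hp : p ≠ ∞ := Fact.out
  obtain ⟨A, hA⟩ := u.exists_finset
  obtain ⟨C, hC⟩ := u.exists_bound
  -- The interval also includes the preceding cell, so that u(r - 1/n) = u(j/n) for r in the j-th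
  -- cell.
  let good : ℕ → ℕ → Prop := fun n j => j ∈ Finset.Ico 1 (n - 1) ∧
    ∀ x ∈ Icc ((j - 1 : ℝ) / n) ((j + 1 : ℝ) / n), x ∉ A
  have hlt1 : ∀ {n j : ℕ}, j ∈ Finset.Ico 1 (n - 1) → (j : ℝ) / n < 1 := fun {n j} hj => by
    rw [Finset.mem_Ico] at hj
    rw [div_lt_one (by exact_mod_cast (by omega : 0 < n))]
    exact_mod_cast (by omega : j < n)
  have hex : ∀ n j : ℕ, ∃ y : lp (fun k => F k) p,
      (good n j → ‖y‖ < fiberNorm p F ((j : ℝ) / n) (u.toFun (j / n)) + ε ∧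
        IsSum p F ((j : ℝ) / n) y (u.toFun (j / n))) ∧ (¬ good n j → y = 0) := fun n j => by
    by_cases h : good n j
    · obtain ⟨y, hy⟩ := exists_lt_fiberNorm_add (hlt1 h.1) (u.mem_fiber (hlt1 h.1)) hε
      exact ⟨y, fun _ => hy, fun h' => absurd h h'⟩
    · exact ⟨0, fun h' => absurd h' h, fun _ => rfl⟩
  choose y hy hy0 using hex
  have hvgood : ∀ {n i : ℕ} {r : ℝ}, r ∈ gridCell n i → good n i →
      (gridStep n (y n)).toFun r = u.toFun r := by
    intro n i r hi hg
    rw [gridStep_apply, sum_indicator_gridCell _ _ hi, if_pos hg.1]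
    have h1 := (isSum_fiberQuot (hlt1 hg.1) (y n i)).unique (hy n i hg).2
    rw [h1]
    refine hA _ _ hi.1.le fun x hx => hg.2 x ⟨?_, hx.2.trans hi.2.le⟩
    refine le_trans ?_ hx.1
    gcongr
    linarith
  have hvbad : ∀ {n i : ℕ} {r : ℝ}, r ∈ gridCell n i → ¬ good n i →
      (gridStep n (y n)).toFun r = 0 ∧ gridLift n (y n) r = 0 := by
    intro n i r hi hg
    rw [gridStep_apply, gridLift, sum_indicator_gridCell _ _ hi, sum_indicator_gridCell _ _ hi,
      hy0 n i hg, damp_zero, ite_self]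
    refine ⟨?_, rfl⟩
    split_ifs with h
    · exact (isSum_fiberQuot (hlt1 h) _).unique (isSum_zero _)
    · rfl
  -- Extension by zero to ℝ makes translation by 1/n measure preserving.
  let H : ℝ → ℝ := (Ioo (0 : ℝ) 1).indicator fun r => fiberNorm p F r (u.toFun r)
  have hH0 : ∀ r, 0 ≤ H r := fun r => indicator_nonneg (fun r _ => fiberNorm_nonneg r _) r
  have hHmeas : AEStronglyMeasurable H volume :=
    (aestronglyMeasurable_indicator_iff measurableSet_Ioo).2 u.memLp.1
  have hHnorm : eLpNorm H p volume = ENNReal.ofReal ‖u‖ := by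
    rw [norm_eq_eLpNorm, ENNReal.ofReal_toReal u.memLp.2.ne,
      eLpNorm_indicator_eq_eLpNorm_restrict measurableSet_Ioo]
  -- The fibre norm decreases with the parameter, so the norm at j/n may exceed that at r. It is
  -- bounded by the norm at the earlier point r - 1/n < j/n.
  have hbound : ∀ n : ℕ, 0 < n → ∀ᵐ r ∂volume.restrict (Ioo (0 : ℝ) 1),
      ‖gridLift n (y n) r‖ ≤ H (r - 1 / n) + ε := by
    intro n hn
    have hn' : (0 : ℝ) < n := by exact_mod_cast hn
    filter_upwards [ae_restrict_of_ae ae_irrational, ae_restrict_mem measurableSet_Ioo]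
      with r hir hr
    obtain ⟨i, hi⟩ := exists_mem_gridCell hn hir hr.1
    by_cases hg : good n i
    · rw [gridLift, sum_indicator_gridCell _ _ hi, if_pos hg.1]
      refine (norm_damp_le _ _).trans ((hy n i hg).1.le.trans ?_)
      have h1 : (1 : ℝ) ≤ i := by exact_mod_cast (Finset.mem_Ico.1 hg.1).1
      have h2 : (1 : ℝ) / n ≤ i / n := by gcongr
      have h3 := gridCell_dist hi
      have h4 : r - 1 / n ∈ Ioo (0 : ℝ) 1 :=
        ⟨by linarith, by have : 0 < 1 / (n : ℝ) := (by positivity); linarith [hr.2]⟩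
      have h5 : r - 1 / n ≤ i / n := by linarith
      have h6 : u.toFun (r - 1 / n) = u.toFun (i / n) := by
        refine hA _ _ h5 fun x hx => hg.2 x ⟨?_, hx.2.trans ?_⟩
        · refine le_trans ?_ hx.1
          rw [sub_div]; linarith
        · gcongr; linarith
      simp only [H]
      rw [indicator_of_mem h4, h6]
      gcongr
      refine fiberNorm_anti h5 (hlt1 hg.1) ?_
      rw [← h6]
      exact u.mem_fiber h4.2
    · rw [(hvbad hi hg).2, norm_zero]
      linarith [hH0 (r - 1 / n)]
  have hnormf : ∀ n : ℕ, 0 < n → eLpNorm (gridLift n (y n)) p (volume.restrict (Ioo (0 : ℝ) 1)) ≤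
      ENNReal.ofReal (‖u‖ + ε) := by
    intro n hn
    have hmp := measurePreserving_sub_right (volume : Measure ℝ) (1 / (n : ℝ))
    have hHs : AEStronglyMeasurable (fun r => H (r - 1 / n)) volume :=
      hHmeas.comp_measurePreserving hmp
    calc _ ≤ eLpNorm ((fun r => H (r - 1 / n)) + fun _ => ε) p
          (volume.restrict (Ioo (0 : ℝ) 1)) := eLpNorm_mono_ae_real (hbound n hn)
      _ ≤ eLpNorm (fun r => H (r - 1 / n)) p (volume.restrict (Ioo (0 : ℝ) 1)) +
          eLpNorm (fun _ : ℝ => ε) p (volume.restrict (Ioo (0 : ℝ) 1)) :=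
        eLpNorm_add_le hHs.restrict aestronglyMeasurable_const Fact.out
      _ ≤ eLpNorm H p volume + ENNReal.ofReal ε := by
        gcongr
        · refine (eLpNorm_mono_measure _ Measure.restrict_le_self).trans ?_
          exact (eLpNorm_comp_measurePreserving hHmeas hmp).le
        · rw [eLpNorm_const' _ h0 hp]
          simp [abs_of_pos hε, ← ofReal_norm]
      _ = _ := by rw [hHnorm, ENNReal.ofReal_add (norm_nonneg _) hε.le]
  -- The difference vanishes on good cells and equals u on bad ones. Almost every r keeps a positive
  -- distance from A, hence lies in a good cell for all large n.
  have hlim : Tendsto (fun n : ℕ => eLpNorm (fun r => fiberNorm p F r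
      ((u - gridStep n (y n)).toFun r)) p (volume.restrict (Ioo (0 : ℝ) 1))) atTop (𝓝 0) := by
    refine tendsto_eLpNorm_zero_of_bounded h0 hp (C := max C 0)
      (fun n => (StepSpace.memLp _).1) (fun n => ?_) ?_
    · filter_upwards [ae_restrict_of_ae ae_irrational, ae_restrict_mem measurableSet_Ioo]
        with r hir hr
      rw [Real.norm_of_nonneg (fiberNorm_nonneg r _), StepSpace.sub_toFun]
      rcases Nat.eq_zero_or_pos n with rfl | hn
      · rw [gridStep_apply]
        simpa using Or.inl (hC r hr.2)
      obtain ⟨i, hi⟩ := exists_mem_gridCell hn hir hr.1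
      by_cases hg : good n i
      · rw [hvgood hi hg, sub_self, fiberNorm_zero hr.2]
        exact le_max_right _ _
      · rw [(hvbad hi hg).1, sub_zero]
        exact (hC r hr.2).trans (le_max_left _ _)
    · have hAae : ∀ᵐ r : ℝ, r ∉ (A : Set ℝ) := A.countable_toSet.ae_notMem volume
      filter_upwards [ae_restrict_of_ae ae_irrational, ae_restrict_of_ae hAae,
        ae_restrict_mem measurableSet_Ioo] with r hir hrA hr
      obtain ⟨δ, hδ, hball⟩ := Metric.isOpen_iff.1 A.finite_toSet.isClosed.isOpen_compl r hrA
      refine tendsto_const_nhds.congr' ?_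
      filter_upwards [eventually_gt_atTop 0, tendsto_two_div.eventually (gt_mem_nhds hr.1),
        tendsto_two_div.eventually (gt_mem_nhds (show 0 < 1 - r by linarith [hr.2])),
        tendsto_two_div.eventually (gt_mem_nhds hδ)] with n hn ha hb hd
      have hn' : (0 : ℝ) < n := by exact_mod_cast hn
      obtain ⟨i, hi⟩ := exists_mem_gridCell hn hir hr.1
      have hg : good n i := by
        refine ⟨Ico_grid_mem hi hn' ha (by linarith), fun x hx => hball ?_⟩
        have h3 := gridCell_dist hi
        have h4 : (2 : ℝ) / n = 1 / n + 1 / n := by ring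
        rw [mem_Icc, sub_div, add_div] at hx
        rw [Metric.mem_ball, Real.dist_eq, abs_lt]
        constructor <;> linarith [hx.1, hx.2]
      rw [StepSpace.sub_toFun, hvgood hi hg, sub_self, fiberNorm_zero hr.2]
  obtain ⟨n, hn, hn0⟩ := ((hlim.eventually (gt_mem_nhds
    (show (0 : ℝ≥0∞) < ENNReal.ofReal ε by simpa using hε))).and (eventually_gt_atTop 0)).exists
  have hmem := memLp_gridLift n (y n)
  refine ⟨hmem.toLp _, gridStep n (y n), (lifts_gridLift n _).congr hmem.coeFn_toLp.symm, ?_, ?_⟩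
  · rw [Lp.norm_toLp]
    exact ENNReal.toReal_le_of_le_ofReal (by positivity) (hnormf n hn0)
  · rw [norm_eq_eLpNorm]
    exact (ENNReal.toReal_lt_of_lt_ofReal hn).le

end NearOptimal

end WillisSpace

namespace WillisSpace

variable {𝕜 : Type*} [RCLike 𝕜] {E : Type*} [NormedAddCommGroup E] [NormedSpace 𝕜 E]
  {p : ℝ≥0∞} [Fact (1 ≤ p)] [Fact (p ≠ ∞)] {F : ℕ → Submodule 𝕜 E}

theorem completeSpace_initialSpan (x : ℕ → E) (N : ℕ → ℕ) (k : ℕ) :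
    CompleteSpace (initialSpan x N k : Submodule 𝕜 E) := by
  have hfin : {v | ∃ m < N k, v = x m}.Finite :=
    ((Set.finite_Iio (N k)).image x).subset (by rintro _ ⟨m, hm, rfl⟩; exact ⟨m, hm, rfl⟩)
  have : FiniteDimensional 𝕜 (initialSpan x N k : Submodule 𝕜 E) :=
    FiniteDimensional.span_of_finite 𝕜 hfin
  exact FiniteDimensional.complete 𝕜 _

/-! ### Consequences of a coordinate system. -/

section Embedding

variable {Y Z : Type*} [NormedAddCommGroup Y] [NormedSpace 𝕜 Y] [NormedAddCommGroup Z] [NormedSpace 𝕜 Z]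

theorem clarkson_Lp_of_coordinates (hp : p ≠ ∞) (h2 : 2 ≤ p.toReal)
    (hc : ∃ c : ℕ → Y →L[𝕜] 𝕜, ∀ y, ∑' m, ‖c m y‖ₑ ^ p.toReal = ‖y‖ₑ ^ p.toReal) :
    Clarkson p.toReal (Lp Y p (volume.restrict (Ioo (0 : ℝ) 1))) := by
  obtain ⟨c, hc⟩ := hc
  obtain ⟨J⟩ := exists_linearIsometry_Lp hp hc
  have h0 : p ≠ 0 := (zero_lt_one.trans_le (Fact.out : 1 ≤ p)).ne'
  have h3 := (clarkson_rclike (𝕜 := 𝕜) h2).lp (μ := volume.restrict (Ioo (0 : ℝ) 1)) h0 hp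
  exact h3.of_isometry J.toLinearMap.toAddMonoidHom J.norm_map

theorem exists_isMetricQuotientMap_of_coordinates [CompleteSpace Y] (hp : p ≠ ∞)
    (hc : ∃ c : ℕ → Y →L[𝕜] 𝕜, ∀ y, ∑' m, ‖c m y‖ₑ ^ p.toReal = ‖y‖ₑ ^ p.toReal)
    (Q : Lp Y p (volume.restrict (Ioo (0 : ℝ) 1)) →L[𝕜] Z) (hQ : IsMetricQuotientMap Q) :
    ∃ M : Submodule 𝕜 (Lp 𝕜 p (volume.restrict (Ioo (0 : ℝ) 1))),
      IsClosed (M : Set (Lp 𝕜 p (volume.restrict (Ioo (0 : ℝ) 1)))) ∧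
      ∃ T : M →L[𝕜] Z, IsMetricQuotientMap T := by
  obtain ⟨c, hc⟩ := hc
  obtain ⟨J⟩ := exists_linearIsometry_Lp hp hc
  refine ⟨LinearMap.range J.toLinearMap, ?_, ?_⟩
  · rw [LinearMap.coe_range]
    exact J.isometry.isClosedEmbedding.isClosed_range
  · let e := J.equivRange
    refine ⟨Q.comp e.symm.toContinuousLinearEquiv.toContinuousLinearMap, ?_⟩
    have h1 : e.symm '' Metric.ball 0 1 = Metric.ball 0 1 := by
      rw [LinearIsometryEquiv.image_ball, map_zero]
    change (Q ∘ e.symm) '' Metric.ball 0 1 = _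
    rw [image_comp, h1]
    exact hQ

end Embedding

/-! ### Construction of the quotient map onto Z^♯. -/

section QuotientMap

/-- Well-definedness of the quotient map: the zero function lifts u - v, which therefore has norm 0.
-/
theorem Lifts.coe_eq {f : Lp (lp (fun k => F k) p) p (volume.restrict (Ioo (0 : ℝ) 1))}
    {u v : StepSpace p F} (hu : Lifts f u) (hv : Lifts f v) : (u : ZSharp p F) = v := by
  have h1 : Lifts (0 : Lp (lp (fun k => F k) p) p (volume.restrict (Ioo (0 : ℝ) 1)))
      (u - v) := by
    refine (hu.sub hv).congr ?_
    rw [sub_self]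
    exact (Lp.coeFn_zero _ _ _).symm
  have h2 : ‖u - v‖ ≤ 0 := by simpa using h1.norm_le_Lp
  rw [← sub_eq_zero, ← UniformSpace.Completion.coe_sub, ← norm_le_zero_iff,
    UniformSpace.Completion.norm_coe]
  exact h2

variable (p F) in
/-- The functions in `L^p((0,1), (⨁ X_k)_{ℓ^p})` that lift a step function. -/
def liftable : Submodule 𝕜 (Lp (lp (fun k => F k) p) p (volume.restrict (Ioo (0 : ℝ) 1))) where
  carrier := {f | ∃ u : StepSpace p F, Lifts f u}
  add_mem' := by
    rintro f g ⟨u, hu⟩ ⟨v, hv⟩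
    exact ⟨u + v, (hu.add hv).congr (Lp.coeFn_add f g).symm⟩
  zero_mem' := ⟨0, lifts_zero.congr (Lp.coeFn_zero _ _ _).symm⟩
  smul_mem' := by
    rintro c f ⟨u, hu⟩
    exact ⟨c • u, (hu.smul c).congr (Lp.coeFn_smul c f).symm⟩

/-- A step function lifted by `f`. -/
noncomputable def liftableStep (f : liftable p F) : StepSpace p F := f.2.choose

theorem lifts_liftableStep (f : liftable p F) : Lifts f.1 (liftableStep f) := f.2.choose_spec

theorem liftableStep_add (f g : liftable p F) :
    (liftableStep (f + g) : ZSharp p F) = liftableStep f + liftableStep g := by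
  rw [← UniformSpace.Completion.coe_add]
  refine (lifts_liftableStep (f + g)).coe_eq ?_
  exact ((lifts_liftableStep f).add (lifts_liftableStep g)).congr (Lp.coeFn_add f.1 g.1).symm

theorem liftableStep_smul (c : 𝕜) (f : liftable p F) :
    (liftableStep (c • f) : ZSharp p F) = c • (liftableStep f : ZSharp p F) := by
  rw [← UniformSpace.Completion.coe_smul]
  refine (lifts_liftableStep (c • f)).coe_eq ?_
  exact ((lifts_liftableStep f).smul c).congr (Lp.coeFn_smul c f.1).symm

theorem norm_liftableStep_le (f : liftable p F) :
    ‖(liftableStep f : ZSharp p F)‖ ≤ 1 * ‖f‖ := by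
  rw [one_mul, UniformSpace.Completion.norm_coe]
  exact (lifts_liftableStep f).norm_le_Lp

variable (p F) in
/-- The quotient map on the liftable functions. -/
noncomputable def liftableQuot : liftable p F →L[𝕜] ZSharp p F :=
  LinearMap.mkContinuous
    { toFun := fun f => (liftableStep f : ZSharp p F)
      map_add' := liftableStep_add
      map_smul' := liftableStep_smul } 1 norm_liftableStep_le

theorem liftableQuot_apply (f : liftable p F) {u : StepSpace p F} (h : Lifts f.1 u) :
    liftableQuot p F f = u :=
  (lifts_liftableStep f).coe_eq h

theorem denseRange_liftable [CompleteSpace E] : DenseRange (liftable p F).subtypeL := by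
  intro f
  rw [Metric.mem_closure_iff]
  intro ε hε
  obtain ⟨g, u, hgu, hfg⟩ := exists_lifts_near f hε
  exact ⟨g, ⟨⟨g, u, hgu⟩, rfl⟩, by rwa [dist_eq_norm]⟩

variable (p F) in
/-- The quotient map `L^p((0,1), (⨁ X_k)_{ℓ^p}) → Z^♯`, `(Q f)(t) = Q_t (f t)`. -/
noncomputable def stepQuot :
    Lp (lp (fun k => F k) p) p (volume.restrict (Ioo (0 : ℝ) 1)) →L[𝕜] ZSharp p F :=
  (liftableQuot p F).extend (liftable p F).subtypeL

theorem stepQuot_apply [CompleteSpace E]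
    {f : Lp (lp (fun k => F k) p) p (volume.restrict (Ioo (0 : ℝ) 1))} {u : StepSpace p F}
    (h : Lifts f u) : stepQuot p F f = u := by
  have h1 := ContinuousLinearMap.extend_eq (liftableQuot p F) (e := (liftable p F).subtypeL)
    denseRange_liftable isUniformEmbedding_subtype_val.isUniformInducing ⟨f, u, h⟩
  exact h1.trans (liftableQuot_apply _ h)

theorem exists_seq_lifts [CompleteSpace E]
    (f : Lp (lp (fun k => F k) p) p (volume.restrict (Ioo (0 : ℝ) 1))) :
    ∃ (g : ℕ → Lp (lp (fun k => F k) p) p (volume.restrict (Ioo (0 : ℝ) 1)))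
      (u : ℕ → StepSpace p F), (∀ n, Lifts (g n) (u n)) ∧ Tendsto g atTop (𝓝 f) := by
  have h := fun n : ℕ => exists_lifts_near f (Nat.one_div_pos_of_nat (n := n) (α := ℝ))
  choose g u hgu hfg using h
  refine ⟨g, u, hgu, tendsto_iff_norm_sub_tendsto_zero.2 ?_⟩
  refine squeeze_zero (fun _ => norm_nonneg _) (fun n => ?_)
    (tendsto_one_div_add_atTop_nhds_zero_nat (𝕜 := ℝ))
  rw [norm_sub_rev]
  exact (hfg n).le

theorem norm_stepQuot_le [CompleteSpace E]
    (f : Lp (lp (fun k => F k) p) p (volume.restrict (Ioo (0 : ℝ) 1))) :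
    ‖stepQuot p F f‖ ≤ ‖f‖ := by
  obtain ⟨g, u, hgu, hg⟩ := exists_seq_lifts f
  refine le_of_tendsto_of_tendsto' (((stepQuot p F).continuous.tendsto f).comp hg).norm hg.norm
    fun n => ?_
  rw [Function.comp_apply, stepQuot_apply (hgu n), UniformSpace.Completion.norm_coe]
  exact (hgu n).norm_le_Lp

theorem isMetricQuotientMap_stepQuot [CompleteSpace E] [∀ k, CompleteSpace (F k)] :
    IsMetricQuotientMap (stepQuot p F) := by
  refine isMetricQuotientMap_of_approx _ norm_stepQuot_le fun z ε hε => ?_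
  obtain ⟨u, hu⟩ : ∃ u : StepSpace p F, ‖z - u‖ < ε / 3 := by
    obtain ⟨_, ⟨u, rfl⟩, hu⟩ := Metric.mem_closure_iff.1
      (UniformSpace.Completion.denseRange_coe z) (ε / 3) (by positivity)
    exact ⟨u, by rwa [dist_eq_norm] at hu⟩
  obtain ⟨f, v, hfv, hf, huv⟩ := exists_lifts_norm_le u (show 0 < ε / 3 by positivity)
  refine ⟨f, ?_, ?_⟩
  · have h1 : ‖(u : ZSharp p F)‖ ≤ ‖z‖ + ‖z - u‖ := by
      rw [norm_sub_rev]
      exact norm_le_norm_add_norm_sub' _ _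
    rw [UniformSpace.Completion.norm_coe] at h1
    linarith
  · rw [stepQuot_apply hfv]
    have h1 : z - (v : ZSharp p F) = (z - u) + ((u - v : StepSpace p F) : ZSharp p F) := by
      rw [UniformSpace.Completion.coe_sub]; abel
    rw [h1]
    refine (norm_add_le _ _).trans ?_
    rw [UniformSpace.Completion.norm_coe]
    linarith

/-- Gives the pointwise convergence of fibre norms behind the measurability claim in
`represents_stepQuot`. -/
theorem abs_fiberNorm_sub_le {t : ℝ} (ht : t < 1) {v w : E} (hv : v ∈ fiber p F t)
    (hw : w ∈ fiber p F t) : |fiberNorm p F t v - fiberNorm p F t w| ≤ fiberNorm p F t (v - w) := by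
  have h1 := fiberNorm_add_le ht (sub_mem hv hw) hw
  have h2 := fiberNorm_add_le ht (sub_mem hw hv) hv
  have h3 : fiberNorm p F t (w - v) ≤ fiberNorm p F t (v - w) := by
    have := fiberNorm_smul_le (p := p) ht (sub_mem hv hw) (-1 : 𝕜)
    simpa using this
  rw [sub_add_cancel] at h1 h2
  rw [abs_le]
  constructor <;> linarith

theorem represents_stepQuot [CompleteSpace E]
    (f : Lp (lp (fun k => F k) p) p (volume.restrict (Ioo (0 : ℝ) 1))) :
    Represents p F (fun t => fiberQuot p F t (f t)) (stepQuot p F f) := by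
  have h0 : p ≠ 0 := (zero_lt_one.trans_le (Fact.out : 1 ≤ p)).ne'
  have hp : p ≠ ∞ := Fact.out
  have hq := toReal_pos' p
  obtain ⟨g, u, hgu, hg⟩ := exists_seq_lifts f
  have hfib : ∀ r < 1, fiberQuot p F r (f r) ∈ fiber p F r := fun r hr =>
    (mem_fiber_iff hr).2 ⟨_, isSum_fiberQuot hr _⟩
  have hdiff : ∀ n, ∀ᵐ r ∂volume.restrict (Ioo (0 : ℝ) 1),
      fiberNorm p F r (fiberQuot p F r (f r) - (u n).toFun r) ≤ ‖f r - g n r‖ := fun n => by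
    filter_upwards [hgu n, ae_restrict_mem measurableSet_Ioo] with r h1 hr
    refine fiberNorm_le hr.2 ?_
    have h2 := (isSum_fiberQuot hr.2 (f r)).add (h1.smul (-1 : 𝕜))
    rwa [neg_one_smul, neg_one_smul, ← sub_eq_add_neg, ← sub_eq_add_neg] at h2
  refine ⟨?_, u, ?_, fun n => ?_, ?_⟩
  · filter_upwards [ae_restrict_mem measurableSet_Ioo] with r hr using hfib r hr.2
  · exact (((stepQuot p F).continuous.tendsto f).comp hg).congr fun n => stepQuot_apply (hgu n)
  -- Along a subsequence the lifts converge almost everywhere, so the function is an a.e. limit of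
  -- fibre norms of step functions, which are measurable.
  · obtain ⟨φ, -, hφ⟩ := (tendstoInMeasure_of_tendsto_Lp hg).exists_seq_tendsto_ae
    refine aemeasurable_of_tendsto_metrizable_ae atTop
      (f := fun m r => fiberNorm p F r ((u (φ m) - u n).toFun r))
      (fun m => StepSpace.aemeasurable _) ?_
    filter_upwards [hφ, ae_all_iff.2 hdiff, ae_restrict_mem measurableSet_Ioo] with r h1 h2 hr
    rw [tendsto_iff_norm_sub_tendsto_zero]
    refine squeeze_zero (fun _ => norm_nonneg _) (fun m => ?_)
      (tendsto_iff_norm_sub_tendsto_zero.1 h1)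
    rw [norm_sub_rev, norm_sub_rev (g (φ m) r), Real.norm_eq_abs, StepSpace.sub_toFun]
    refine (abs_fiberNorm_sub_le hr.2 (sub_mem (hfib r hr.2) ((u n).mem_fiber hr.2))
      (sub_mem ((u (φ m)).mem_fiber hr.2) ((u n).mem_fiber hr.2))).trans ?_
    rw [sub_sub_sub_cancel_right]
    exact h2 (φ m)
  · have h1 : Tendsto (fun n => ‖f - g n‖ₑ ^ p.toReal) atTop (𝓝 0) := by
      have h2 := (ENNReal.continuous_rpow_const (y := p.toReal)).tendsto _ |>.comp
        (hg.const_sub f).enorm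
      simpa [Function.comp_def, ENNReal.zero_rpow_of_pos hq] using h2
    refine tendsto_of_tendsto_of_tendsto_of_le_of_le tendsto_const_nhds h1
      (fun _ => zero_le) fun n => ?_
    rw [enorm_rpow_eq_lintegral h0 hp]
    refine lintegral_mono_ae ?_
    filter_upwards [hdiff n, Lp.coeFn_sub f (g n)] with r h3 h4
    rw [h4, Pi.sub_apply, ← ofReal_norm]
    exact ENNReal.rpow_le_rpow (ENNReal.ofReal_le_ofReal h3) hq.le

end QuotientMap

/-! ### The four conclusions. -/

theorem quotient_reflexive_uniformConvex [CompleteSpace E] [∀ k, CompleteSpace (F k)] (hp : 2 < p)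
    (hc : ∃ c : ℕ → lp (fun k => F k) p →L[𝕜] 𝕜,
      ∀ y, ∑' m, ‖c m y‖ₑ ^ p.toReal = ‖y‖ₑ ^ p.toReal) :
    (∃ Q : Lp (lp (fun k => F k) p) p (volume.restrict (Ioo (0 : ℝ) 1)) →L[𝕜] ZSharp p F,
      (∀ f, Represents p F (fun t => fiberQuot p F t (f t)) (Q f)) ∧ IsMetricQuotientMap Q) ∧
    (∃ M : Submodule 𝕜 (Lp 𝕜 p (volume.restrict (Ioo (0 : ℝ) 1))),
      IsClosed (M : Set (Lp 𝕜 p (volume.restrict (Ioo (0 : ℝ) 1)))) ∧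
      ∃ T : M →L[𝕜] ZSharp p F, IsMetricQuotientMap T) ∧
    Function.Surjective (NormedSpace.inclusionInDoubleDual 𝕜 (ZSharp p F)) ∧
    UniformConvexSpace (ZSharp p F) := by
  have hp' : p ≠ ∞ := Fact.out
  have h2 : 2 ≤ p.toReal := by simpa using ENNReal.toReal_mono hp' hp.le
  have hQ : IsMetricQuotientMap (stepQuot p F) := isMetricQuotientMap_stepQuot
  have hL : Clarkson p.toReal (Lp (lp (fun k => F k) p) p (volume.restrict (Ioo (0 : ℝ) 1))) :=
    clarkson_Lp_of_coordinates hp' h2 hc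
  have huc : UniformConvexSpace (ZSharp p F) :=
    (hL.of_isMetricQuotientMap (toReal_pos' p) hQ).uniformConvexSpace (toReal_pos' p)
  exact ⟨⟨stepQuot p F, represents_stepQuot, hQ⟩,
    exists_isMetricQuotientMap_of_coordinates hp' hc _ hQ,
    surjective_inclusionInDoubleDual_of_uniformConvex, huc⟩

end WillisSpace

theorem proposition3 {𝕜 : Type*} [RCLike 𝕜] {p : ℝ≥0∞} [Fact (1 ≤ p)] [Fact (p ≠ ∞)]
    (hp : 2 < p)
    -- a closed subspace `X` of `ℓ^p`
    (X : Submodule 𝕜 (lp (fun _ : ℕ => 𝕜) p)) (hX : IsClosed (X : Set (lp (fun _ : ℕ => 𝕜) p)))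
    -- the sequence `x 0, x 1, …` is `x_1, x_2, …`, and `N k` is `n_{k+1}`
    (x : ℕ → X) (hx_le : ∀ n, ‖x n‖ ≤ 1) (hx_anti : Antitone fun n => ‖x n‖)
    (hx_lim : Tendsto (fun n => ‖x n‖) atTop (𝓝 0))
    (N : ℕ → ℕ) (hN : StrictMono N) (hxN : ∀ k n, N k ≤ n → ‖x n‖ < (1 / 2 : ℝ) ^ (k + 1))
    -- the subspaces `X_{k+1} = span {x_1, …, x_{n_{k+1}}}`
    (F : ℕ → Submodule 𝕜 X) (hF : F = WillisSpace.initialSpan x N) :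
    -- the map `(Q f)(t) = Q_t (f t)` is a quotient map of `L^p((0,1), (⨁ X_k)_{ℓ^p})` onto `Z^♯`
    (∃ Q : Lp (lp (fun k => F k) p) p (volume.restrict (Ioo (0 : ℝ) 1)) →L[𝕜]
        WillisSpace.ZSharp p F,
      (∀ f, WillisSpace.Represents p F (fun t => WillisSpace.fiberQuot p F t (f t)) (Q f)) ∧
      WillisSpace.IsMetricQuotientMap Q) ∧
    -- `Z^♯` is a quotient of a closed subspace of `L^p(0,1)`
    (∃ M : Submodule 𝕜 (Lp 𝕜 p (volume.restrict (Ioo (0 : ℝ) 1))),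
      IsClosed (M : Set (Lp 𝕜 p (volume.restrict (Ioo (0 : ℝ) 1)))) ∧
      ∃ T : M →L[𝕜] WillisSpace.ZSharp p F, WillisSpace.IsMetricQuotientMap T) ∧
    -- `Z^♯` is reflexive
    Function.Surjective (NormedSpace.inclusionInDoubleDual 𝕜 (WillisSpace.ZSharp p F)) ∧
    -- `Z^♯` is uniformly convex
    UniformConvexSpace (WillisSpace.ZSharp p F) := by
  have : CompleteSpace X := hX.completeSpace_coe
  have : ∀ k, CompleteSpace (F k) := fun k => by
    rw [hF]
    exact WillisSpace.completeSpace_initialSpan x N k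
  exact WillisSpace.quotient_reflexive_uniformConvex hp
    (WillisSpace.exists_coordinates Fact.out F)
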